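/- **Setting.** Let $U$ be a unitary on a finite-dimensional complex Hilbert space with orthonormal eigenbasis $U|\phi_j\rangle=e^{i\phi_j}|\phi_j\rangle$, $\phi_j\in[0,2\pi)$, let $|\psi\rangle$ be a unit vector and put $a_j=|\langle\phi_j|\psi\rangle|^2$. For $\sigma>0$ let $f_\sigma$ be the $2\pi$-periodic Gaussian kernel that equals $e^{-x^2/2\sigma^2}\big/\int_{-\pi}^{\pi}e^{-y^2/2\sigma^2}\,dy$ on $(-\pi,\pi]$. One run of the (noiseless) phase estimation circuit makes $t$ calls to controlled-$U$ and returns a sample from the density $p(x)=\sum_j a_j f_\sigma(x-\phi_j)$ on $[0,2\pi)$, where $\sigma=\Theta(t^{-1})$, i.e. $\kappa_1\le t\sigma\le\kappa_2$ for fixed constants $0<\kappa_1\le\kappa_2$ (the cost of approximating the exact Gaussian kernel is neglected). Given $\phi_{\rm guess}$ and $\Delta$, put $\mathcal D=[\phi_{\rm guess}-\Delta/2,\ \phi_{\rm guess}+\Delta/2]$. The filtered moment projection phase estimator (fMPE) with $M$ filtered samples runs the circuit independently, discarding outcomes outside $\mathcal D$, until $M$ outcomes $x_1,\dots,x_M\in\mathcal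 D$ have been accepted, and returns $$\tilde\phi=\operatorname*{arg\,max}_{\phi\in\mathcal D}\ \frac1M\sum_{i=1}^M\log Q(x_i|\phi),\qquad Q(x|\phi)=\frac{f_\sigma(x-\phi)}{\int_{\mathcal D}f_\sigma(y-\phi)\,dy}.$$ **Theorem (cost of noiseless fMPE).** For all $0<\kappa_1\le\kappa_2$ there is a constant $c_0>0$ such that for every $B>0$ there is a constant $C>0$ with the following property. Let $0<\Delta\le\pi$, $\eta>0$, $0<\varepsilon\le\Delta$, $\sigma>0$ and $t\in\mathbb N$ satisfy $\kappa_1\le t\sigma\le\kappa_2$, $$t\ \ge\ c_0\,\Delta^{-1}\log^{1/2}\!\big(\Delta\varepsilon^{-1}\eta^{-1}\big)\qquad\text{and}\qquad t\varepsilon\le B .$$ Then there is a number $M\ge1$ of filtered samples, not depending on $U$, $\psi$ or $\phi_{\rm guess}$, such that for all $U$, $|\psi\rangle$, target eigenphase $\phi_0$ and $\phi_{\rm guess}$ with * $|\phi_j-\phi_0|>\Delta$ for all $j\ne0$ (spectral gap), * $|\langle\phi_0|\psi\rangle|^2>\eta$ (overlap), * $|\phi_0-\phi_{\rm guess}|<\Delta/3$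 (initial guess), * $\mathcal D\subseteq[\Delta/6,\,2\pi-\Delta/6)$ (the interval does not wrap around the circle), the fMPE is well defined (the maximizer exists and is unique for all samples in $\mathcal D$), its root-mean-square error satisfies $\sqrt{\mathbb E[(\tilde\phi-\phi_0)^2]}\le\varepsilon$, the expected total number of circuit samples (accepted or not) is at most $C\,\eta^{-1}t^{-2}\varepsilon^{-2}$, and the expected total number of calls to $U$ is at most $C\,\eta^{-1}t^{-1}\varepsilon^{-2}$. -/

import Mathlib

open MeasureTheory ProbabilityTheory
open scoped ENNReal

namespace PhaseEstimation

noncomputable section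

/-- An orthonormal eigenbasis of a unitary `U`, with eigenvalues `exp (i φ_j)` and eigenphases
`φ_j ∈ [0, 2π)`. -/
structure EigenDecomposition {H : Type*} [NormedAddCommGroup H] [InnerProductSpace ℂ H]
    (U : H ≃ₗᵢ[ℂ] H) (ι : Type*) [Fintype ι] where
  basis : OrthonormalBasis ι ℂ H
  phase : ι → ℝ
  phase_mem : ∀ j, phase j ∈ Set.Ico 0 (2 * Real.pi)
  eigen : ∀ j, U (basis j) = Complex.exp (phase j * Complex.I) • basis j

/-- The weight `a_j = |⟨φ_j|ψ⟩|²` of the state `ψ` on the `j`-th eigenvector. -/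
def EigenDecomposition.weight {H : Type*} [NormedAddCommGroup H] [InnerProductSpace ℂ H]
    {U : H ≃ₗᵢ[ℂ] H} {ι : Type*} [Fintype ι] (E : EigenDecomposition U ι) (ψ : H) (j : ι) : ℝ :=
  ‖inner ℂ (E.basis j) ψ‖ ^ 2

/-- The Gaussian kernel of width `σ` on the circle: the `2π`-periodic function that equals
`exp (-x² / 2σ²) / ∫_{-π}^{π} exp (-y² / 2σ²) dy` for `x ∈ (-π, π]`. -/
def gaussianKernel (σ x : ℝ) : ℝ :=
  Real.exp (-(toIocMod Real.two_pi_pos (-Real.pi) x) ^ 2 / (2 * σ ^ 2)) /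
    ∫ y in (-Real.pi)..Real.pi, Real.exp (-y ^ 2 / (2 * σ ^ 2))

/-- The smoothed spectral distribution: the measure on `[0, 2π)` with density
`x ↦ ∑_j a_j f (x - φ_j)`.  It is the law of the outcome of one run of the (noiseless) phase
estimation circuit with kernel `f`. -/
def EigenDecomposition.outcomeLaw {H : Type*} [NormedAddCommGroup H] [InnerProductSpace ℂ H]
    {U : H ≃ₗᵢ[ℂ] H} {ι : Type*} [Fintype ι] (E : EigenDecomposition U ι) (ψ : H)
    (f : ℝ → ℝ) : Measure ℝ :=
  (volume.restrict (Set.Ico 0 (2 * Real.pi))).withDensity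
    fun x => ENNReal.ofReal (∑ j, E.weight ψ j * f (x - E.phase j))

/-- The single-phase model `Q(x|φ) = f (x - φ) / ∫_D f (y - φ) dy` on the interval `D`. -/
def singlePhaseModel (f : ℝ → ℝ) (D : Set ℝ) (x φ : ℝ) : ℝ :=
  f (x - φ) / ∫ y in D, f (y - φ)

/-- The log-likelihood `(1/M) ∑_j log Q(x_j|φ)` of the samples `x_1, …, x_M`. -/
def logLikelihood (Q : ℝ → ℝ → ℝ) {M : ℕ} (x : Fin M → ℝ) (φ : ℝ) : ℝ :=
  (1 / (M : ℝ)) * ∑ j, Real.log (Q (x j) φ)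

/-- `φ` is a moment projection estimate from the samples `x`: it maximizes the log-likelihood of
the model `Q` over the parameter set `Dφ`. -/
def IsMomentProjection (Q : ℝ → ℝ → ℝ) (Dφ : Set ℝ) {M : ℕ} (x : Fin M → ℝ) (φ : ℝ) : Prop :=
  φ ∈ Dφ ∧ IsMaxOn (logLikelihood Q x) Dφ φ

/-- The filtered moment projection phase estimate with kernel `f` and filter interval `D`. -/
def IsFMPE (f : ℝ → ℝ) (D : Set ℝ) {M : ℕ} (x : Fin M → ℝ) (φ : ℝ) : Prop :=
  IsMomentProjection (singlePhaseModel f D) D x φ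

/-- The number of circuit runs made until the first outcome in `D` (infinite if there is none),
for the sequence `x 0, x 1, …` of outcomes of successive runs. -/
def runsUntilAccept (D : Set ℝ) (x : ℕ → ℝ) : ℝ≥0∞ :=
  ⨅ (k : ℕ) (_ : x k ∈ D), ((k : ℝ≥0∞) + 1)

/-- The first outcome in `D`. -/
def firstAccepted (D : Set ℝ) (x : ℕ → ℝ) : ℝ :=
  x (sInf {k | x k ∈ D})

/-- The `M` filtered samples produced by rejection; `x i k` is the outcome of the `k`-th run made
to obtain the `i`-th filtered sample. -/
def filteredSamples (D : Set ℝ) {M : ℕ} (x : Fin M → ℕ → ℝ) : Fin M → ℝ :=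
  fun i => firstAccepted D (x i)

/-- The total number of circuit runs made to obtain `M` filtered samples by rejection. -/
def totalRuns (D : Set ℝ) {M : ℕ} (x : Fin M → ℕ → ℝ) : ℝ≥0∞ :=
  ∑ i, runsUntilAccept D (x i)

/-- The total number of calls to `U` if each circuit run makes `t` calls. -/
def totalCalls (t : ℕ) (D : Set ℝ) {M : ℕ} (x : Fin M → ℕ → ℝ) : ℝ≥0∞ :=
  t * totalRuns D x

/-- The filter interval of length `Δ` centred at `g`. -/
def filterInterval (g Δ : ℝ) : Set ℝ := Set.Icc (g - Δ / 2) (g + Δ / 2)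

end

end PhaseEstimation

/-!
The normal laws `N(φ, σ²)` conditioned to the filter interval `D` form an exponential family with
natural parameter `φ / σ²`. Hence the log-likelihood depends on the samples only through their
mean, and its derivative in `φ` is the sample mean minus the mean of the truncated law, up to the
factor `σ²`. The truncated mean increases in `φ` with slope `Var / σ²`, which is bounded below by a
constant once `D` is longer than `σ`. The estimate is therefore unique, and its error is at most a
constant times the distance from the sample mean to the truncated mean at the target phase.

On `D` the outcome law is a multiple of the normal law around the target phase plus the tails of
the other phases, whose relative mass is exponentially small in `(Δ / σ)²`. This adds a bias below
`ε` to the sample mean and keeps its variance of order `σ² / M`, so `M` of order `σ² / ε²` suffices.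
Each accepted sample costs `1 / P(D)` runs on average, which is of order `1 / η`. If `Δ` is only a
constant multiple of `σ`, the lower bound on `t` forces every point of `D` to be within `ε` of the
target, and one sample suffices.
-/

namespace PhaseEstimation

open Real Set
open scoped NNReal

noncomputable section

/-! ### Maximizers and variational inequalities -/

section Variational

lemma mul_sub_nonpos_of_isMaxOn {D : Set ℝ} (hD : Convex ℝ D) {f : ℝ → ℝ} {f' x y : ℝ}
    (hf : HasDerivAt f f' x) (hmax : IsMaxOn f D x) (hx : x ∈ D) (hy : y ∈ D) :
    f' * (y - x) ≤ 0 := by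
  have := hmax.localize.hasFDerivWithinAt_nonpos hf.hasFDerivAt.hasFDerivWithinAt
    (sub_mem_posTangentConeAt_of_segment_subset (hD.segment_subset hx hy))
  simpa [mul_comm] using this

lemma mul_sq_sub_le_of_le_deriv {D : Set ℝ} (hD : Convex ℝ D) {m m' : ℝ → ℝ} {c x y : ℝ}
    (hm : ∀ z ∈ D, HasDerivAt m (m' z) z) (hc : ∀ z ∈ D, c ≤ m' z) (hx : x ∈ D) (hy : y ∈ D) :
    c * (y - x) ^ 2 ≤ (m y - m x) * (y - x) := by
  have hslope : ∀ ⦃u⦄, u ∈ D → ∀ ⦃w⦄, w ∈ D → u ≤ w → c * (w - u) ≤ m w - m u := fun u hu w hw =>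
    hD.mul_sub_le_image_sub_of_le_deriv
      (fun z hz => (hm z hz).continuousAt.continuousWithinAt)
      (fun z hz => (hm z (interior_subset hz)).differentiableAt.differentiableWithinAt)
      (fun z hz => (hm z (interior_subset hz)).deriv ▸ hc z (interior_subset hz)) u hu w hw
  rcases le_total x y with hxy | hxy
  · nlinarith [hslope hx hy hxy]
  · nlinarith [hslope hy hx hxy]

lemma mul_abs_sub_le_of_variational {c s s' x x' r r' : ℝ}
    (hmono : c * (x' - x) ^ 2 ≤ (r' - r) * (x' - x))
    (h : (s - r) * (x' - x) ≤ 0) (h' : (s' - r') * (x - x') ≤ 0) :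
    c * |x' - x| ≤ |s' - s| := by
  rcases eq_or_ne x' x with rfl | hne
  · simp
  refine le_of_mul_le_mul_right ?_ (abs_pos.2 (sub_ne_zero.2 hne))
  calc c * |x' - x| * |x' - x| = c * (x' - x) ^ 2 := by rw [mul_assoc, abs_mul_abs_self, sq]
    _ ≤ (s' - s) * (x' - x) := by linarith
    _ ≤ |s' - s| * |x' - x| := (le_abs_self _).trans_eq (abs_mul _ _)

end Variational

/-! ### Truncated normal laws as an exponential family -/

section TruncatedGaussian

variable {v : ℝ≥0} {D : Set ℝ}

lemma integrableExpSet_restrict_gaussianReal (φ : ℝ) (v : ℝ≥0) (D : Set ℝ) :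
    integrableExpSet id ((gaussianReal φ v).restrict D) = univ :=
  eq_univ_of_forall fun _ => (integrable_exp_mul_gaussianReal _).integrableOn

lemma gaussianPDFReal_eq_exp_mul (hv : v ≠ 0) (φ y : ℝ) :
    gaussianPDFReal φ v y = exp (φ / v * y - φ ^ 2 / (2 * v)) * gaussianPDFReal 0 v y := by
  have : (v : ℝ) ≠ 0 := by simpa using hv
  rw [gaussianPDFReal, gaussianPDFReal, mul_left_comm, ← exp_add]
  congr 2
  field_simp
  ring

lemma gaussianReal_apply_ne_zero (hv : v ≠ 0) (φ : ℝ) (hD : volume D ≠ 0) :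
    gaussianReal φ v D ≠ 0 :=
  fun h => hD (gaussianReal_absolutelyContinuous' φ hv h)

lemma gaussianReal_eq_withDensity_exp (hv : v ≠ 0) (φ : ℝ) :
    gaussianReal φ v = (gaussianReal 0 v).withDensity
      fun y => ENNReal.ofReal (exp (φ / v * y - φ ^ 2 / (2 * v))) := by
  rw [gaussianReal_of_var_ne_zero _ hv, gaussianReal_of_var_ne_zero _ hv,
    ← withDensity_mul _ (measurable_gaussianPDF 0 v) (by fun_prop)]
  congr 1 with y
  rw [Pi.mul_apply, mul_comm, gaussianPDF, gaussianPDF, ← ENNReal.ofReal_mul (by positivity),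
    gaussianPDFReal_eq_exp_mul hv φ y]

lemma mgf_restrict_gaussianReal (hv : v ≠ 0) (hD : MeasurableSet D) (φ : ℝ) :
    mgf id ((gaussianReal 0 v).restrict D) (φ / v) =
      exp (φ ^ 2 / (2 * v)) * (gaussianReal φ v).real D := by
  rw [gaussianReal_eq_withDensity_exp hv φ, Measure.real, withDensity_apply _ hD,
    ← integral_eq_lintegral_of_nonneg_ae (ae_of_all _ fun _ => by positivity) (by fun_prop),
    ← integral_const_mul]
  refine integral_congr_ae (ae_of_all _ fun y => ?_)
  simp only [id_eq, ← exp_add]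
  ring_nf

lemma tilted_restrict_gaussianReal (hv : v ≠ 0) (hD : MeasurableSet D) (hD₀ : volume D ≠ 0)
    (φ : ℝ) :
    ((gaussianReal 0 v).restrict D).tilted (φ / v * id ·) = (gaussianReal φ v)[|D] := by
  have hmass := gaussianReal_apply_ne_zero hv φ hD₀
  ext s hs
  rw [tilted_mul_apply_mgf' hs, mgf_restrict_gaussianReal hv hD, cond_apply hD, inter_comm,
    ← ENNReal.ofReal_toReal (ENNReal.inv_ne_top.2 hmass), ENNReal.toReal_inv,
    Measure.restrict_restrict hs, gaussianReal_eq_withDensity_exp hv φ,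
    withDensity_apply _ (hs.inter hD), ← gaussianReal_eq_withDensity_exp hv φ,
    ← lintegral_const_mul _ (by fun_prop)]
  refine lintegral_congr fun y => ?_
  rw [← ENNReal.ofReal_mul (by positivity), exp_sub, Measure.real, id]
  congr 1
  field_simp

/-- The mean of the normal law `N(φ, v)` conditioned to `D`. -/
def truncatedMean (v : ℝ≥0) (D : Set ℝ) (φ : ℝ) : ℝ := ∫ y, y ∂(gaussianReal φ v)[|D]

/-- The log-likelihood of a sample with mean `s` in the family `φ ↦ N(φ, v)` conditioned to `D`, up
to a constant that depends on the sample only. This is an exponential family with natural parameter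
`φ / v`, so its log-partition function is a cumulant generating function. -/
def truncatedLogLikelihood (v : ℝ≥0) (D : Set ℝ) (s φ : ℝ) : ℝ :=
  s * (φ / v) - cgf id ((gaussianReal 0 v).restrict D) (φ / v)

lemma deriv_cgf_restrict_gaussianReal (hv : v ≠ 0) (hD : MeasurableSet D) (hD₀ : volume D ≠ 0)
    (φ : ℝ) :
    deriv (cgf id ((gaussianReal 0 v).restrict D)) (φ / v) = truncatedMean v D φ := by
  rw [← integral_tilted_mul_self (by simp [integrableExpSet_restrict_gaussianReal]),
    tilted_restrict_gaussianReal hv hD hD₀]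
  rfl

lemma hasDerivAt_truncatedLogLikelihood (hv : v ≠ 0) (hD : MeasurableSet D) (hD₀ : volume D ≠ 0)
    (s φ : ℝ) :
    HasDerivAt (truncatedLogLikelihood v D s) ((s - truncatedMean v D φ) / v) φ := by
  have hcgf := (analyticAt_cgf (X := id) (μ := (gaussianReal 0 v).restrict D) (v := φ / v)
    (by simp [integrableExpSet_restrict_gaussianReal])).differentiableAt.hasDerivAt
  rw [deriv_cgf_restrict_gaussianReal hv hD hD₀] at hcgf
  have hdiv : HasDerivAt (fun ξ : ℝ => ξ / v) (1 / v) φ := (hasDerivAt_id φ).div_const _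
  refine ((hdiv.const_mul s).sub (hcgf.comp φ hdiv)).congr_deriv ?_
  ring

lemma hasDerivAt_truncatedMean (hv : v ≠ 0) (hD : MeasurableSet D) (hD₀ : volume D ≠ 0) (φ : ℝ) :
    HasDerivAt (truncatedMean v D) (Var[id; (gaussianReal φ v)[|D]] / v) φ := by
  have hinteg : φ / v ∈ interior (integrableExpSet id ((gaussianReal 0 v).restrict D)) := by
    simp [integrableExpSet_restrict_gaussianReal]
  have hcgf := (analyticAt_cgf hinteg).deriv.differentiableAt.hasDerivAt
  rw [← iteratedDeriv_one, ← iteratedDeriv_succ, ← variance_tilted_mul hinteg,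
    tilted_restrict_gaussianReal hv hD hD₀, iteratedDeriv_one] at hcgf
  rw [← funext (deriv_cgf_restrict_gaussianReal hv hD hD₀)]
  refine (hcgf.comp φ ((hasDerivAt_id φ).div_const (v : ℝ))).congr_deriv ?_
  ring

lemma sub_truncatedMean_mul_nonpos_of_isMaxOn (hv : v ≠ 0) (hD : MeasurableSet D)
    (hD₀ : volume D ≠ 0) (hconv : Convex ℝ D) {s φ φ' : ℝ} (hφ : φ ∈ D) (hφ' : φ' ∈ D)
    (hmax : IsMaxOn (truncatedLogLikelihood v D s) D φ) :
    (s - truncatedMean v D φ) * (φ' - φ) ≤ 0 := by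
  have hfirst := mul_sub_nonpos_of_isMaxOn hconv
    (hasDerivAt_truncatedLogLikelihood hv hD hD₀ s φ) hmax hφ hφ'
  rw [div_mul_eq_mul_div] at hfirst
  exact nonpos_of_mul_nonpos_left hfirst (by positivity)

lemma mul_abs_sub_le_of_isMaxOn (hv : v ≠ 0) (hD : MeasurableSet D) (hD₀ : volume D ≠ 0)
    (hconv : Convex ℝ D) {c s s' φ φ' : ℝ} (hφ : φ ∈ D) (hφ' : φ' ∈ D)
    (hc : ∀ ξ ∈ D, c ≤ Var[id; (gaussianReal ξ v)[|D]] / v)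
    (hmax : IsMaxOn (truncatedLogLikelihood v D s) D φ)
    (hmax' : IsMaxOn (truncatedLogLikelihood v D s') D φ') :
    c * |φ' - φ| ≤ |s' - s| :=
  mul_abs_sub_le_of_variational
    (mul_sq_sub_le_of_le_deriv hconv (fun ξ _ => hasDerivAt_truncatedMean hv hD hD₀ ξ) hc hφ hφ')
    (sub_truncatedMean_mul_nonpos_of_isMaxOn hv hD hD₀ hconv hφ hφ' hmax)
    (sub_truncatedMean_mul_nonpos_of_isMaxOn hv hD hD₀ hconv hφ' hφ hmax')

lemma mul_abs_sub_le_abs_sub_truncatedMean (hv : v ≠ 0) (hD : MeasurableSet D)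
    (hD₀ : volume D ≠ 0) (hconv : Convex ℝ D) {c s φ φ₀ : ℝ} (hφ : φ ∈ D) (hφ₀ : φ₀ ∈ D)
    (hc : ∀ ξ ∈ D, c ≤ Var[id; (gaussianReal ξ v)[|D]] / v)
    (hmax : IsMaxOn (truncatedLogLikelihood v D s) D φ) :
    c * |φ - φ₀| ≤ |s - truncatedMean v D φ₀| :=
  mul_abs_sub_le_of_variational
    (mul_sq_sub_le_of_le_deriv hconv (fun ξ _ => hasDerivAt_truncatedMean hv hD hD₀ ξ) hc hφ₀ hφ)
    (by simp)
    (sub_truncatedMean_mul_nonpos_of_isMaxOn hv hD hD₀ hconv hφ hφ₀ hmax)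

lemma exists_continuous_isMaxOn_iff (hv : v ≠ 0) (hcompact : IsCompact D) (hD₀ : volume D ≠ 0)
    (hconv : Convex ℝ D) {c : ℝ} (hc₀ : 0 < c)
    (hc : ∀ ξ ∈ D, c ≤ Var[id; (gaussianReal ξ v)[|D]] / v) :
    ∃ F : ℝ → ℝ, Continuous F ∧
      ∀ s φ, φ ∈ D ∧ IsMaxOn (truncatedLogLikelihood v D s) D φ ↔ φ = F s := by
  have hD := hcompact.measurableSet
  have hexists : ∀ s, ∃ φ ∈ D, IsMaxOn (truncatedLogLikelihood v D s) D φ := fun s =>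
    hcompact.exists_isMaxOn (nonempty_of_measure_ne_zero hD₀) fun φ _ =>
      (hasDerivAt_truncatedLogLikelihood hv hD hD₀ s φ).continuousAt.continuousWithinAt
  choose F hF hmax using hexists
  have hlip : LipschitzWith (c.toNNReal)⁻¹ F := LipschitzWith.of_dist_le_mul fun s s' => by
    have hle := mul_abs_sub_le_of_isMaxOn hv hD hD₀ hconv (hF s') (hF s) hc (hmax s') (hmax s)
    rwa [NNReal.coe_inv, Real.coe_toNNReal c hc₀.le, dist_eq, dist_eq, ← div_eq_inv_mul,
      le_div_iff₀' hc₀]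
  refine ⟨F, hlip.continuous, fun s φ => ⟨fun ⟨hφ, hφmax⟩ => ?_, ?_⟩⟩
  · have hle := mul_abs_sub_le_of_isMaxOn hv hD hD₀ hconv (hF s) hφ hc (hmax s) hφmax
    rw [sub_self, abs_zero] at hle
    exact sub_eq_zero.1 (abs_nonpos_iff.1 (nonpos_of_mul_nonpos_right hle hc₀))
  · rintro rfl
    exact ⟨hF s, hmax s⟩

end TruncatedGaussian

/-! ### Lower bounds for the mass and the variance -/

section MassAndVariance

variable {σ : ℝ≥0} {a b φ : ℝ}

lemma le_gaussianPDFReal_of_abs_sub_le (hσ : σ ≠ 0) {y : ℝ} (hy : |y - φ| ≤ σ / 2) :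
    1 / (4 * σ) ≤ gaussianPDFReal φ (σ ^ 2) y := by
  have hσ₀ : (0 : ℝ) < σ := by positivity
  have hsqrt : √(2 * π * (σ ^ 2 : ℝ≥0)) ≤ 3 * σ := by
    rw [sqrt_le_left (by positivity)]
    push_cast
    nlinarith [pi_lt_d2, sq_pos_of_pos hσ₀]
  have hexp : 3 / 4 ≤ exp (-(y - φ) ^ 2 / (2 * (σ ^ 2 : ℝ≥0))) := by
    refine le_trans ?_ (add_one_le_exp _)
    have : (y - φ) ^ 2 / (2 * (σ ^ 2 : ℝ≥0)) ≤ 1 / 4 := by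
      rw [div_le_iff₀ (by positivity)]
      push_cast
      nlinarith [sq_le_sq' (abs_le.1 hy).1 (abs_le.1 hy).2, sq_pos_of_pos hσ₀]
    rw [neg_div]
    linarith
  calc 1 / (4 * (σ : ℝ)) = (3 * (σ : ℝ))⁻¹ * (3 / 4) := by field_simp
    _ ≤ _ := by
      rw [gaussianPDFReal]
      gcongr

lemma exists_Icc_add_subset_inter {r ℓ : ℝ} (hℓ₀ : 0 ≤ ℓ) (hℓr : ℓ ≤ r) (hℓ : ℓ ≤ (b - a) / 2)
    (hφ : φ ∈ Icc a b) :
    ∃ p, Icc p (p + ℓ) ⊆ Icc a b ∩ Icc (φ - r) (φ + r) := by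
  rcases le_total φ ((a + b) / 2) with hmid | hmid
  · refine ⟨φ, fun y hy => ⟨⟨?_, ?_⟩, ?_, ?_⟩⟩ <;> linarith [hy.1, hy.2, hφ.1, hφ.2]
  · refine ⟨φ - ℓ, fun y hy => ⟨⟨?_, ?_⟩, ?_, ?_⟩⟩ <;> linarith [hy.1, hy.2, hφ.1, hφ.2]

lemma exists_smul_volume_le_restrict_gaussianReal (hσ : σ ≠ 0) (hφ : φ ∈ Icc a b) :
    ∃ p, ENNReal.ofReal (1 / (4 * σ)) • volume.restrict (Icc p (p + min (σ : ℝ) (b - a) / 2)) ≤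
      (gaussianReal φ (σ ^ 2)).restrict (Icc a b) := by
  have hmin : 0 ≤ min (σ : ℝ) (b - a) := le_min σ.coe_nonneg (by linarith [hφ.1, hφ.2])
  obtain ⟨p, hp⟩ := exists_Icc_add_subset_inter (r := σ / 2) (ℓ := min (σ : ℝ) (b - a) / 2)
    (by linarith) (by linarith [min_le_left (σ : ℝ) (b - a)])
    (by linarith [min_le_right (σ : ℝ) (b - a)]) hφ
  refine ⟨p, le_trans ?_ (Measure.restrict_mono_set _ fun y hy => (hp hy).1)⟩
  rw [gaussianReal_of_var_ne_zero _ (pow_ne_zero 2 hσ), restrict_withDensity measurableSet_Icc,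
    ← withDensity_const]
  refine withDensity_mono ?_
  filter_upwards [ae_restrict_mem measurableSet_Icc] with y hy
  have hdist := (hp hy).2
  exact ENNReal.ofReal_le_ofReal (le_gaussianPDFReal_of_abs_sub_le hσ
    (abs_le.2 ⟨by linarith [hdist.1], by linarith [hdist.2]⟩))

lemma div_le_gaussianReal_Icc (hσ : σ ≠ 0) (hφ : φ ∈ Icc a b) :
    min (σ : ℝ) (b - a) / (8 * σ) ≤ (gaussianReal φ (σ ^ 2)).real (Icc a b) := by
  have hmin : 0 ≤ min (σ : ℝ) (b - a) := le_min σ.coe_nonneg (by linarith [hφ.1, hφ.2])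
  obtain ⟨p, hp⟩ := exists_smul_volume_le_restrict_gaussianReal hσ hφ
  have hle := ENNReal.toReal_mono (measure_ne_top _ _) (hp univ)
  rw [Measure.restrict_apply_univ, Measure.smul_apply, Measure.restrict_apply_univ, volume_Icc,
    add_sub_cancel_left, smul_eq_mul, ENNReal.toReal_mul, ENNReal.toReal_ofReal (by positivity),
    ENNReal.toReal_ofReal (by positivity)] at hle
  exact le_trans (le_of_eq (by ring)) hle

lemma cube_div_le_integral_sq_sub {ℓ : ℝ} (hℓ : 0 ≤ ℓ) (p m : ℝ) :
    ℓ ^ 3 / 12 ≤ ∫ y in Icc p (p + ℓ), (y - m) ^ 2 := by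
  rw [integral_Icc_eq_integral_Ioc, ← intervalIntegral.integral_of_le (by linarith),
    intervalIntegral.integral_comp_sub_right (fun y => y ^ 2), integral_pow]
  norm_num
  nlinarith [mul_nonneg hℓ (sq_nonneg (2 * (p - m) + ℓ))]

lemma mul_cube_div_le_variance {μ : Measure ℝ} [IsProbabilityMeasure μ] (hμ : MemLp id 2 μ)
    {κ p ℓ : ℝ} (hκ : 0 ≤ κ) (hℓ : 0 ≤ ℓ)
    (hle : ENNReal.ofReal κ • volume.restrict (Icc p (p + ℓ)) ≤ μ) :
    κ * (ℓ ^ 3 / 12) ≤ Var[id; μ] := by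
  have hinteg : Integrable (fun y => (y - μ[id]) ^ 2) μ := (hμ.sub (memLp_const _)).integrable_sq
  calc κ * (ℓ ^ 3 / 12) ≤ κ * ∫ y in Icc p (p + ℓ), (y - μ[id]) ^ 2 := by
        gcongr
        exact cube_div_le_integral_sq_sub hℓ p _
    _ = ∫ y, (y - μ[id]) ^ 2 ∂(ENNReal.ofReal κ • volume.restrict (Icc p (p + ℓ))) := by
        rw [integral_smul_measure, ENNReal.toReal_ofReal hκ, smul_eq_mul]
    _ ≤ ∫ y, (y - μ[id]) ^ 2 ∂μ :=
        integral_mono_measure hle (ae_of_all _ fun _ => sq_nonneg _) hinteg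
    _ = Var[id; μ] := (variance_eq_integral aemeasurable_id).symm

lemma cube_div_le_variance_cond_gaussianReal (hσ : σ ≠ 0) (hab : a < b) (hφ : φ ∈ Icc a b) :
    min (σ : ℝ) (b - a) ^ 3 / (384 * σ) ≤ Var[id; (gaussianReal φ (σ ^ 2))[|Icc a b]] := by
  have : 0 ≤ min (σ : ℝ) (b - a) := le_min σ.coe_nonneg (by linarith)
  have hmass : gaussianReal φ (σ ^ 2) (Icc a b) ≠ 0 :=
    gaussianReal_apply_ne_zero (pow_ne_zero 2 hσ) φ (by simpa using hab)
  have := cond_isProbabilityMeasure hmass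
  have hlp : MemLp id 2 (gaussianReal φ (σ ^ 2))[|Icc a b] :=
    (memLp_id_gaussianReal 2).restrict _ |>.smul_measure (ENNReal.inv_ne_top.2 hmass)
  obtain ⟨p, hp⟩ := exists_smul_volume_le_restrict_gaussianReal hσ hφ
  have hcond :
      (gaussianReal φ (σ ^ 2)).restrict (Icc a b) ≤ (gaussianReal φ (σ ^ 2))[|Icc a b] := by
    rw [ProbabilityTheory.cond]
    intro s
    exact le_mul_of_one_le_left' (ENNReal.one_le_inv.2 prob_le_one)
  refine le_trans (le_of_eq ?_) (mul_cube_div_le_variance hlp (by positivity) (by positivity)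
    (hp.trans hcond))
  ring

lemma one_div_le_variance_cond_gaussianReal_div (hσ : σ ≠ 0) (hσab : σ ≤ b - a)
    (hφ : φ ∈ Icc a b) : 1 / 384 ≤ Var[id; (gaussianReal φ (σ ^ 2))[|Icc a b]] / σ ^ 2 := by
  have hσ₀ : (0 : ℝ) < σ := by positivity
  have hvar := cube_div_le_variance_cond_gaussianReal hσ (by linarith) hφ
  rw [min_eq_left hσab] at hvar
  rw [le_div_iff₀ (by positivity)]
  refine le_of_eq_of_le ?_ hvar
  field_simp

end MassAndVariance

/-! ### Contaminated conditional laws -/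

section Contamination

variable {α : Type*} [MeasurableSpace α]

lemma abs_average_add_measure_sub_average_le {τ ν : Measure α} [IsFiniteMeasure τ]
    [NeZero τ] [IsFiniteMeasure ν] {h : α → ℝ} (hhτ : Integrable h τ) (hhν : Integrable h ν)
    {l u : ℝ} (hτmem : ∀ᵐ y ∂τ, h y ∈ Icc l u) (hνmem : ∀ᵐ y ∂ν, h y ∈ Icc l u) :
    |⨍ y, h y ∂(τ + ν) - ⨍ y, h y ∂τ| ≤ (u - l) * (ν.real univ / τ.real univ) := by
  have hτ₀ : 0 < τ.real univ := measureReal_univ_pos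
  have hτavg := (convex_Icc l u).average_mem isClosed_Icc hτmem hhτ
  rcases eq_zero_or_neZero ν with rfl | _
  · simp
  have hνavg := (convex_Icc l u).average_mem isClosed_Icc hνmem hhν
  have hmix : ⨍ y, h y ∂(τ + ν) - ⨍ y, h y ∂τ =
      ν.real univ / (τ.real univ + ν.real univ) * (⨍ y, h y ∂ν - ⨍ y, h y ∂τ) := by
    rw [average_add_measure hhτ hhν, smul_eq_mul, smul_eq_mul]
    field_simp
    ring
  have hdiff : |⨍ y, h y ∂ν - ⨍ y, h y ∂τ| ≤ u - l :=
    abs_le.2 ⟨by linarith [hνavg.1, hτavg.2], by linarith [hνavg.2, hτavg.1]⟩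
  rw [hmix, abs_mul, abs_of_nonneg (by positivity), mul_comm (u - l)]
  gcongr
  simp

lemma integral_cond_eq_setAverage (μ : Measure α) (D : Set α) (h : α → ℝ) :
    ∫ y, h y ∂μ[|D] = ⨍ y in D, h y ∂μ := by
  rw [setAverage_eq', ProbabilityTheory.cond]

lemma average_nnreal_smul_measure {μ : Measure α} {c : ℝ≥0} (hc : c ≠ 0) (h : α → ℝ) :
    ⨍ y, h y ∂(c • μ) = ⨍ y, h y ∂μ := by
  rw [average_eq, average_eq, measureReal_nnreal_smul_apply, integral_smul_nnreal_measure]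
  simp only [smul_eq_mul, NNReal.smul_def]
  field_simp

lemma abs_integral_cond_sub_integral_cond_le {P G ν : Measure α} [IsFiniteMeasure P]
    [IsFiniteMeasure G] {D : Set α} (hD : MeasurableSet D) (hGD : G D ≠ 0) {c : ℝ≥0} (hc : c ≠ 0)
    (hP : P.restrict D = c • G.restrict D + ν) {h : α → ℝ} (hh : Measurable h) {l u : ℝ}
    (hmem : ∀ y ∈ D, h y ∈ Icc l u) :
    |∫ y, h y ∂P[|D] - ∫ y, h y ∂G[|D]| ≤ (u - l) * (ν.real univ / (c * G.real D)) := by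
  have hνP : ν ≤ P.restrict D := hP ▸ Measure.le_add_left le_rfl
  have : IsFiniteMeasure ν := isFiniteMeasure_of_le _ hνP
  have hmemG : ∀ᵐ y ∂(c • G.restrict D), h y ∈ Icc l u :=
    Measure.ae_smul_measure ((ae_restrict_mem hD).mono hmem) _
  have hmemν : ∀ᵐ y ∂ν, h y ∈ Icc l u := ae_mono hνP ((ae_restrict_mem hD).mono hmem)
  have : NeZero (c • G.restrict D) := ⟨by simpa [hc] using hGD⟩
  rw [integral_cond_eq_setAverage, integral_cond_eq_setAverage, hP,
    ← average_nnreal_smul_measure (μ := G.restrict D) hc]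
  refine (abs_average_add_measure_sub_average_le (.of_mem_Icc l u hh.aemeasurable hmemG)
    (.of_mem_Icc l u hh.aemeasurable hmemν) hmemG hmemν).trans_eq ?_
  rw [measureReal_nnreal_smul_apply, measureReal_restrict_apply_univ]

lemma variance_id_le_integral_sq_sub {μ : Measure ℝ} [IsProbabilityMeasure μ] (c : ℝ) :
    Var[id; μ] ≤ ∫ y, (y - c) ^ 2 ∂μ :=
  (variance_sub_const aestronglyMeasurable_id c).symm.trans_le
    (variance_le_expectation_sq (aestronglyMeasurable_id.sub aestronglyMeasurable_const))

lemma integral_sq_sub_cond_gaussianReal_le {v : ℝ≥0} {D : Set ℝ} (φ : ℝ) :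
    ∫ y, (y - φ) ^ 2 ∂(gaussianReal φ v)[|D] ≤ v / (gaussianReal φ v).real D := by
  have hvar : ∫ y, (y - φ) ^ 2 ∂gaussianReal φ v = v := by
    rw [← variance_id_gaussianReal (μ := φ), variance_eq_integral aemeasurable_id]
    simp [integral_id_gaussianReal]
  rw [integral_cond_eq_setAverage, setAverage_eq, smul_eq_mul, ← div_eq_inv_mul, ← hvar]
  refine div_le_div_of_nonneg_right (setIntegral_le_integral ?_ ?_) measureReal_nonneg
  · exact ((memLp_id_gaussianReal 2).sub (memLp_const φ)).integrable_sq
  · exact ae_of_all _ fun _ => sq_nonneg _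

lemma variance_cond_le_of_restrict_eq {P ν : Measure ℝ} [IsFiniteMeasure P] {v c : ℝ≥0} {a b φ : ℝ}
    (hφ : φ ∈ Icc a b) (hPD : P (Icc a b) ≠ 0) (hGD : gaussianReal φ v (Icc a b) ≠ 0) (hc : c ≠ 0)
    (hP : P.restrict (Icc a b) = c • (gaussianReal φ v).restrict (Icc a b) + ν) :
    Var[id; P[|Icc a b]] ≤ v / (gaussianReal φ v).real (Icc a b) +
      (b - a) ^ 2 * (ν.real univ / (c * (gaussianReal φ v).real (Icc a b))) := by
  have := cond_isProbabilityMeasure hPD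
  have hmem : ∀ y ∈ Icc a b, (y - φ) ^ 2 ∈ Icc 0 ((b - a) ^ 2) := fun y hy =>
    ⟨sq_nonneg _, sq_le_sq' (by linarith [hy.1, hφ.2]) (by linarith [hy.2, hφ.1])⟩
  have hdiff := le_of_abs_le (abs_integral_cond_sub_integral_cond_le measurableSet_Icc hGD hc hP
    (h := fun y => (y - φ) ^ 2) (by fun_prop) hmem)
  linarith [variance_id_le_integral_sq_sub (μ := P[|Icc a b]) φ,
    integral_sq_sub_cond_gaussianReal_le (v := v) (D := Icc a b) φ]

end Contamination

/-! ### Rejection sampling -/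

section Rejection

variable {P : Measure ℝ} {D : Set ℝ}

lemma firstAccepted_of_forall_lt_notMem {x : ℕ → ℝ} {k : ℕ} (hlt : ∀ l < k, x l ∉ D)
    (hk : x k ∈ D) : firstAccepted D x = x k := by
  have hfirst : IsLeast {k | x k ∈ D} k := ⟨hk, fun l hl => not_lt.1 fun hlk => hlt l hlk hl⟩
  rw [firstAccepted, hfirst.csInf_eq]

lemma firstAccepted_of_forall_notMem {x : ℕ → ℝ} (h : ∀ k, x k ∉ D) : firstAccepted D x = x 0 := by
  rw [firstAccepted, eq_empty_of_forall_notMem (s := {k | x k ∈ D}) h, Nat.sInf_empty]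

lemma measurable_firstAccepted (hD : MeasurableSet D) : Measurable (firstAccepted D) := by
  classical
  have hex : ∀ x : ℕ → ℝ, ∃ k, x k ∈ D ∨ ∀ l, x l ∉ D := fun x => by
    by_cases h : ∃ k, x k ∈ D
    · exact h.imp fun _ => Or.inl
    · exact ⟨0, .inr (not_exists.1 h)⟩
  have hfind : firstAccepted D = fun x => x (Nat.find (hex x)) := by
    funext x
    by_cases h : ∃ k, x k ∈ D
    · have hor : ∀ k, (x k ∈ D ∨ ∀ l, x l ∉ D) → x k ∈ D := fun k hk =>
        hk.resolve_right (not_forall_not.2 h)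
      exact firstAccepted_of_forall_lt_notMem
        (fun l hl hlD => Nat.find_min (hex x) hl (.inl hlD)) (hor _ (Nat.find_spec (hex x)))
    · rw [firstAccepted_of_forall_notMem (not_exists.1 h),
        (Nat.find_eq_zero (hex x)).2 (.inr (not_exists.1 h))]
  rw [hfind]
  refine Measurable.find (f := fun k (x : ℕ → ℝ) => x k) (fun k => measurable_pi_apply k)
    (fun k => ?_) hex
  have hmem (l : ℕ) : MeasurableSet {x : ℕ → ℝ | x l ∈ D} := measurable_pi_apply l hD
  simp only [ofPred_or, ofPred_forall]
  exact (hmem k).union (.iInter fun l => (hmem l).compl)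

lemma measurableSet_forall_lt_notMem (hD : MeasurableSet D) (k : ℕ) :
    MeasurableSet {x : ℕ → ℝ | ∀ l < k, x l ∉ D} := by
  simp only [ofPred_forall]
  have hmem (l : ℕ) : MeasurableSet {x : ℕ → ℝ | x l ∈ D} := measurable_pi_apply l hD
  exact .iInter fun l => .iInter fun _ => (hmem l).compl

lemma infinitePi_forall_lt_notMem_inter [IsProbabilityMeasure P] (hD : MeasurableSet D) (k : ℕ)
    {S : Set ℝ} (hS : MeasurableSet S) :
    Measure.infinitePi (fun _ : ℕ => P) ({x | ∀ l < k, x l ∉ D} ∩ {x | x k ∈ S}) =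
      (1 - P D) ^ k * P S := by
  have hbox : {x : ℕ → ℝ | ∀ l < k, x l ∉ D} ∩ {x | x k ∈ S} =
      Set.pi (Finset.range (k + 1)) (Function.update (fun _ => Dᶜ) k S) := by
    ext x
    simp only [mem_inter_iff, mem_ofPred_eq, Set.mem_pi, Finset.coe_range, mem_Iio]
    refine ⟨fun ⟨hlt, hk⟩ l hl => ?_, fun h => ⟨fun l hl => ?_, by simpa using h k k.lt_succ_self⟩⟩
    · rcases (Nat.lt_succ_iff.1 hl).eq_or_lt with rfl | hl
      · simpa using hk
      · simpa [hl.ne] using hlt l hl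
    · simpa [hl.ne] using h l (hl.trans k.lt_succ_self)
  rw [hbox, Measure.infinitePi_pi, Finset.prod_range_succ, Function.update_self,
    Finset.prod_congr rfl (g := fun _ => 1 - P D), Finset.prod_const, Finset.card_range]
  · intro l hl
    rw [Function.update_of_ne (Finset.mem_range.1 hl).ne, prob_compl_eq_one_sub hD]
  · intro l _
    rcases eq_or_ne l k with rfl | hl
    · simpa using hS
    · simpa [hl] using hD

lemma tsum_one_sub_measure_pow [IsProbabilityMeasure P] (D : Set ℝ) :
    ∑' k : ℕ, (1 - P D) ^ k = (P D)⁻¹ := by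
  rw [ENNReal.tsum_geometric, ENNReal.sub_sub_cancel ENNReal.one_ne_top prob_le_one]

lemma runsUntilAccept_eq_tsum (D : Set ℝ) (x : ℕ → ℝ) :
    runsUntilAccept D x = ∑' k : ℕ, {y : ℕ → ℝ | ∀ l < k, y l ∉ D}.indicator 1 x := by
  by_cases h : ∃ k, x k ∈ D
  · classical
    set n := Nat.find h
    have hruns : runsUntilAccept D x = n + 1 :=
      le_antisymm (iInf₂_le n (Nat.find_spec h))
        (le_iInf₂ fun k hk => by gcongr; exact Nat.find_min' h hk)
    have hiff (k : ℕ) : x ∈ {y : ℕ → ℝ | ∀ l < k, y l ∉ D} ↔ k ∈ Finset.range (n + 1) := by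
      rw [Finset.mem_range, Nat.lt_succ_iff, Nat.le_find_iff, mem_ofPred_eq]
    rw [hruns, tsum_eq_sum fun k hk => indicator_of_notMem (mt (hiff k).1 hk) _,
      Finset.sum_congr rfl fun k hk => indicator_of_mem ((hiff k).2 hk) _]
    simp
  · simp [runsUntilAccept, not_exists.1 h]

lemma measurable_runsUntilAccept (hD : MeasurableSet D) : Measurable (runsUntilAccept D) := by
  simp only [funext (runsUntilAccept_eq_tsum D)]
  exact Measurable.tsum fun k =>
    measurable_one.indicator (measurableSet_forall_lt_notMem hD k)

lemma lintegral_runsUntilAccept [IsProbabilityMeasure P] (hD : MeasurableSet D) :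
    ∫⁻ x, runsUntilAccept D x ∂Measure.infinitePi (fun _ : ℕ => P) = (P D)⁻¹ := by
  have hmeas := measurableSet_forall_lt_notMem hD
  simp only [runsUntilAccept_eq_tsum]
  rw [lintegral_tsum fun k => (measurable_one.indicator (hmeas k)).aemeasurable,
    ← tsum_one_sub_measure_pow]
  congr 1 with k
  rw [lintegral_indicator_one (hmeas k)]
  simpa using infinitePi_forall_lt_notMem_inter (P := P) hD k .univ

lemma infinitePi_map_firstAccepted [IsProbabilityMeasure P] (hD : MeasurableSet D)
    (hPD : P D ≠ 0) :
    (Measure.infinitePi fun _ : ℕ => P).map (firstAccepted D) = P[|D] := by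
  have hfirst := measurable_firstAccepted hD
  have := Measure.isProbabilityMeasure_map (μ := Measure.infinitePi fun _ : ℕ => P)
    hfirst.aemeasurable
  have := cond_isProbabilityMeasure (μ := P) (s := D) hPD
  refine (Measure.eq_of_le_of_isProbabilityMeasure (Measure.le_iff.2 fun S hS => ?_)).symm
  rw [cond_apply hD, Measure.map_apply hfirst hS, ← tsum_one_sub_measure_pow,
    ← ENNReal.tsum_mul_right]
  simp_rw [← infinitePi_forall_lt_notMem_inter hD _ (hD.inter hS)]
  rw [← measure_iUnion]
  · refine measure_mono (iUnion_subset fun k x ⟨hlt, hk⟩ => ?_)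
    rw [mem_preimage, firstAccepted_of_forall_lt_notMem hlt hk.1]
    exact hk.2
  · intro k k' hne
    refine Set.disjoint_left.2 fun x h h' => ?_
    rcases hne.lt_or_gt with hlt | hlt
    · exact h'.1 k hlt h.2.1
    · exact h.1 k' hlt h'.2.1
  · exact fun k => (measurableSet_forall_lt_notMem hD k).inter
      (measurable_pi_apply k (hD.inter hS))

variable {Ω : Type*} [MeasurableSpace Ω] {μ : Measure Ω} [IsProbabilityMeasure P] {M : ℕ}
  {X : Fin M → ℕ → Ω → ℝ}

lemma hasLaw_pi_infinitePi (hlaw : ∀ i k, HasLaw (X i k) P μ)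
    (hind : iIndepFun (fun p : Fin M × ℕ => X p.1 p.2) μ) :
    HasLaw (fun ω i k => X i k ω)
      (Measure.pi fun _ : Fin M => Measure.infinitePi fun _ : ℕ => P) μ := by
  have hpairs := hind.hasLaw_infinitePi (fun p : Fin M × ℕ => hlaw p.1 p.2)
    (aemeasurable_pi_lambda _ fun p : Fin M × ℕ => (hlaw p.1 p.2).aemeasurable)
  have hcurry : HasLaw (MeasurableEquiv.curry (Fin M) ℕ ℝ)
      (Measure.pi fun _ : Fin M => Measure.infinitePi fun _ : ℕ => P)
      (Measure.infinitePi fun _ : Fin M × ℕ => P) := by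
    rw [← Measure.infinitePi_eq_pi]
    exact ⟨by fun_prop, Measure.infinitePi_map_curry fun _ _ => P⟩
  exact hcurry.comp hpairs

lemma hasLaw_filteredSamples (hD : MeasurableSet D) (hPD : P D ≠ 0)
    (hlaw : ∀ i k, HasLaw (X i k) P μ) (hind : iIndepFun (fun p : Fin M × ℕ => X p.1 p.2) μ) :
    HasLaw (fun ω => filteredSamples D fun i k => X i k ω)
      (Measure.pi fun _ : Fin M => P[|D]) μ := by
  have hfirst := measurable_firstAccepted hD
  have hfilter : HasLaw (filteredSamples D) (Measure.pi fun _ : Fin M => P[|D])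
      (Measure.pi fun _ : Fin M => Measure.infinitePi fun _ : ℕ => P) := by
    have := Measure.isProbabilityMeasure_map (μ := Measure.infinitePi fun _ : ℕ => P)
      hfirst.aemeasurable
    rw [← infinitePi_map_firstAccepted hD hPD]
    exact ⟨(measurable_pi_lambda _ fun i => hfirst.comp (measurable_pi_apply i)).aemeasurable,
      Measure.pi_map_pi fun _ => hfirst.aemeasurable⟩
  exact hfilter.comp (hasLaw_pi_infinitePi hlaw hind)

lemma lintegral_totalRuns (hD : MeasurableSet D) (hlaw : ∀ i k, HasLaw (X i k) P μ)
    (hind : iIndepFun (fun p : Fin M × ℕ => X p.1 p.2) μ) :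
    ∫⁻ ω, totalRuns D (fun i k => X i k ω) ∂μ = M * (P D)⁻¹ := by
  have hruns (i : Fin M) : Measurable fun x : Fin M → ℕ → ℝ => runsUntilAccept D (x i) :=
    (measurable_runsUntilAccept hD).comp (measurable_pi_apply i)
  have hblock (i : Fin M) : ∫⁻ x, runsUntilAccept D (x i)
      ∂Measure.pi (fun _ : Fin M => Measure.infinitePi fun _ : ℕ => P) = (P D)⁻¹ := by
    rw [(measurePreserving_eval _ i).lintegral_comp (measurable_runsUntilAccept hD),
      lintegral_runsUntilAccept hD]
  calc ∫⁻ ω, totalRuns D (fun i k => X i k ω) ∂μ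
      = ∫⁻ x, ∑ i, runsUntilAccept D (x i)
          ∂Measure.pi (fun _ : Fin M => Measure.infinitePi fun _ : ℕ => P) :=
        (hasLaw_pi_infinitePi hlaw hind).lintegral_comp
          (Finset.measurable_fun_sum _ fun i _ => hruns i).aemeasurable
    _ = M * (P D)⁻¹ := by
        rw [lintegral_finsetSum _ fun i _ => hruns i]
        simp [hblock]

end Rejection

/-! ### Empirical means -/

lemma integral_sq_sub_eq_variance_add {Ω : Type*} [MeasurableSpace Ω] {μ : Measure Ω}
    [IsProbabilityMeasure μ] {X : Ω → ℝ} (hX : MemLp X 2 μ) (m : ℝ) :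
    ∫ ω, (X ω - m) ^ 2 ∂μ = Var[X; μ] + (∫ ω, X ω ∂μ - m) ^ 2 := by
  have hvar : Var[X; μ] = ∫ ω, (X ω - m) ^ 2 ∂μ - (∫ ω, (X ω - m) ∂μ) ^ 2 := by
    rw [← variance_sub_const hX.aestronglyMeasurable m]
    exact variance_eq_sub (hX.sub (memLp_const m))
  have hmean : ∫ ω, (X ω - m) ∂μ = ∫ ω, X ω ∂μ - m := by
    rw [integral_sub (hX.integrable one_le_two) (integrable_const m)]
    simp
  rw [hvar, hmean, sub_add_cancel]

lemma integral_sq_empiricalMean_sub {P : Measure ℝ} [IsProbabilityMeasure P] (hP : MemLp id 2 P)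
    {M : ℕ} (hM : M ≠ 0) (m : ℝ) :
    Integrable (fun x : Fin M → ℝ => (1 / (M : ℝ) * ∑ i, x i - m) ^ 2) (Measure.pi fun _ => P) ∧
      ∫ x : Fin M → ℝ, (1 / (M : ℝ) * ∑ i, x i - m) ^ 2 ∂Measure.pi (fun _ => P) =
        Var[id; P] / M + (∫ y, y ∂P - m) ^ 2 := by
  set μ := Measure.pi fun _ : Fin M => P
  have heval (i : Fin M) : HasLaw (fun x : Fin M → ℝ => x i) P μ :=
    (measurePreserving_eval (fun _ => P) i).hasLaw
  have hLp (i : Fin M) : MemLp (fun x : Fin M → ℝ => x i) 2 μ :=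
    hP.comp_measurePreserving (measurePreserving_eval (fun _ => P) i)
  have hsum : MemLp (∑ i, fun x : Fin M → ℝ => x i) 2 μ := memLp_finsetSum' _ fun i _ => hLp i
  have hbar := hsum.const_mul (1 / (M : ℝ))
  have hvar : Var[fun x => 1 / (M : ℝ) * (∑ i, fun x : Fin M → ℝ => x i) x; μ] =
      Var[id; P] / M := by
    rw [variance_const_mul, IndepFun.variance_sum (fun i _ => hLp i) fun i _ j _ hij =>
      (iIndepFun_pi (μ := fun _ : Fin M => P) (X := fun _ => id)
        fun _ => aemeasurable_id).indepFun hij]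
    simp only [fun i => (heval i).variance_eq, Finset.sum_const, Finset.card_univ,
      Fintype.card_fin, nsmul_eq_mul]
    field_simp
  have hmean : ∫ x, 1 / (M : ℝ) * (∑ i, fun x : Fin M → ℝ => x i) x ∂μ = ∫ y, y ∂P := by
    rw [integral_const_mul]
    simp only [Finset.sum_apply]
    rw [integral_finsetSum _ fun i _ => (hLp i).integrable one_le_two]
    simp only [fun i => (heval i).integral_eq, Finset.sum_const, Finset.card_univ,
      Fintype.card_fin, nsmul_eq_mul]
    field_simp
  simp only [Finset.sum_apply] at hbar hvar hmean
  refine ⟨(hbar.sub (memLp_const m)).integrable_sq, ?_⟩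
  rw [integral_sq_sub_eq_variance_add hbar, hvar, hmean]

/-! ### The Gaussian kernel on the circle -/

section Kernel

variable {σ : ℝ≥0} {D : Set ℝ}

/-- The mass that the normal law `N(0, σ²)` gives to one period. This is the normalization of the
Gaussian kernel on the circle relative to the normal density. -/
def circleMass (σ : ℝ≥0) : ℝ := (gaussianReal 0 (σ ^ 2)).real (Icc (-π) π)

lemma circleMass_pos (hσ : σ ≠ 0) : 0 < circleMass σ :=
  ENNReal.toReal_pos (gaussianReal_apply_ne_zero (pow_ne_zero 2 hσ) 0 (by simp [pi_pos]))
    (measure_ne_top _ _)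

lemma circleMass_le_one (σ : ℝ≥0) : circleMass σ ≤ 1 := measureReal_le_one

lemma gaussianReal_real_eq_integral {v : ℝ≥0} (hv : v ≠ 0) (φ : ℝ) (D : Set ℝ) :
    (gaussianReal φ v).real D = ∫ y in D, gaussianPDFReal φ v y := by
  rw [Measure.real, gaussianReal_apply_eq_integral φ hv, ENNReal.toReal_ofReal]
  exact integral_nonneg fun y => gaussianPDFReal_nonneg φ v y

lemma gaussianKernel_eq_gaussianPDFReal_div (hσ : σ ≠ 0) (x : ℝ) :
    gaussianKernel σ x =
      gaussianPDFReal 0 (σ ^ 2) (toIocMod two_pi_pos (-π) x) / circleMass σ := by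
  have hmass : circleMass σ =
      (√(2 * π * (σ ^ 2 : ℝ≥0)))⁻¹ * ∫ y in (-π)..π, exp (-y ^ 2 / (2 * σ ^ 2)) := by
    rw [circleMass, gaussianReal_real_eq_integral (pow_ne_zero 2 hσ),
      integral_Icc_eq_integral_Ioc, ← intervalIntegral.integral_of_le (by linarith [pi_pos]),
      ← intervalIntegral.integral_const_mul]
    simp [gaussianPDFReal]
  have : (0 : ℝ) < σ := by positivity
  rw [hmass, gaussianPDFReal, sub_zero, mul_div_mul_left _ _ (by positivity), gaussianKernel,
    NNReal.coe_pow]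

lemma gaussianKernel_sub_of_abs_le (hσ : σ ≠ 0) {x φ : ℝ} (h : |x - φ| ≤ π) :
    gaussianKernel σ (x - φ) = gaussianPDFReal φ (σ ^ 2) x / circleMass σ := by
  obtain ⟨hlo, hhi⟩ := abs_le.1 h
  have hsq : (toIocMod two_pi_pos (-π) (x - φ)) ^ 2 = (x - φ) ^ 2 := by
    rcases hlo.eq_or_lt with hend | hlo
    · rw [← hend, toIocMod_apply_left]
      ring
    · rw [(toIocMod_eq_self two_pi_pos).2 ⟨hlo, by linarith⟩]
  rw [gaussianKernel_eq_gaussianPDFReal_div hσ, gaussianPDFReal, gaussianPDFReal, sub_zero, hsq]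

lemma gaussianKernel_nonneg (hσ : σ ≠ 0) (x : ℝ) : 0 ≤ gaussianKernel σ x := by
  rw [gaussianKernel_eq_gaussianPDFReal_div hσ]
  exact div_nonneg (gaussianPDFReal_nonneg _ _ _) (circleMass_pos hσ).le

lemma gaussianKernel_le_of_forall_le_abs (hσ : σ ≠ 0) {x d : ℝ} (hd : 0 ≤ d)
    (h : ∀ n : ℤ, d ≤ |x - n * (2 * π)|) :
    gaussianKernel σ x ≤ gaussianPDFReal 0 (σ ^ 2) d / circleMass σ := by
  have hdist : d ≤ |toIocMod two_pi_pos (-π) x| := by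
    simpa only [toIocMod, zsmul_eq_mul] using h (toIocDiv two_pi_pos (-π) x)
  have hsq : d ^ 2 ≤ toIocMod two_pi_pos (-π) x ^ 2 := by
    rw [← sq_abs (toIocMod _ _ _)]
    gcongr
  have := circleMass_pos hσ
  rw [gaussianKernel_eq_gaussianPDFReal_div hσ, gaussianPDFReal, gaussianPDFReal, sub_zero,
    sub_zero]
  gcongr

lemma measurable_gaussianKernel (σ : ℝ) : Measurable (gaussianKernel σ) := by
  have hmod : Measurable (toIocMod two_pi_pos (-π)) := by
    have hfloor (x : ℝ) : toIocMod two_pi_pos (-π) x =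
        x + ⌊(-π + 2 * π - x) / (2 * π)⌋ * (2 * π) := by
      rw [toIocMod, toIocDiv_eq_neg_floor, zsmul_eq_mul]
      push_cast
      ring
    simp only [funext hfloor]
    fun_prop
  unfold gaussianKernel
  fun_prop

lemma singlePhaseModel_gaussianKernel (hσ : σ ≠ 0) (hD : MeasurableSet D)
    (hdiam : ∀ x ∈ D, ∀ y ∈ D, |x - y| ≤ π) {x φ : ℝ} (hx : x ∈ D) (hφ : φ ∈ D) :
    singlePhaseModel (gaussianKernel σ) D x φ =
      gaussianPDFReal φ (σ ^ 2) x / (gaussianReal φ (σ ^ 2)).real D := by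
  rw [singlePhaseModel, gaussianKernel_sub_of_abs_le hσ (hdiam x hx φ hφ),
    setIntegral_congr_fun hD fun y hy => gaussianKernel_sub_of_abs_le hσ (hdiam y hy φ hφ),
    integral_div, div_div_div_cancel_right₀ (circleMass_pos hσ).ne',
    gaussianReal_real_eq_integral (pow_ne_zero 2 hσ)]

lemma log_singlePhaseModel_gaussianKernel (hσ : σ ≠ 0) (hD : MeasurableSet D)
    (hD₀ : volume D ≠ 0) (hdiam : ∀ x ∈ D, ∀ y ∈ D, |x - y| ≤ π) {x φ : ℝ} (hx : x ∈ D)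
    (hφ : φ ∈ D) :
    log (singlePhaseModel (gaussianKernel σ) D x φ) =
      log (gaussianPDFReal 0 (σ ^ 2) x) + truncatedLogLikelihood (σ ^ 2) D x φ := by
  have hv : σ ^ 2 ≠ 0 := pow_ne_zero 2 hσ
  have hmass : (gaussianReal φ (σ ^ 2)).real D ≠ 0 :=
    (measureReal_ne_zero_iff).2 (gaussianReal_apply_ne_zero hv φ hD₀)
  have hpdf := (gaussianPDFReal_pos 0 (σ ^ 2) x hv).ne'
  rw [singlePhaseModel_gaussianKernel hσ hD hdiam hx hφ, gaussianPDFReal_eq_exp_mul hv,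
    log_div (mul_ne_zero (exp_pos _).ne' hpdf) hmass, log_mul (exp_pos _).ne' hpdf, log_exp,
    truncatedLogLikelihood, cgf, mgf_restrict_gaussianReal hv hD, log_mul (exp_pos _).ne' hmass,
    log_exp]
  ring

lemma logLikelihood_gaussianKernel (hσ : σ ≠ 0) (hD : MeasurableSet D) (hD₀ : volume D ≠ 0)
    (hdiam : ∀ x ∈ D, ∀ y ∈ D, |x - y| ≤ π) {M : ℕ} (hM : M ≠ 0) {x : Fin M → ℝ}
    (hx : ∀ i, x i ∈ D) {φ : ℝ} (hφ : φ ∈ D) :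
    logLikelihood (singlePhaseModel (gaussianKernel σ) D) x φ =
      1 / (M : ℝ) * ∑ i, log (gaussianPDFReal 0 (σ ^ 2) (x i)) +
        truncatedLogLikelihood (σ ^ 2) D (1 / (M : ℝ) * ∑ i, x i) φ := by
  have hM' : (M : ℝ) ≠ 0 := Nat.cast_ne_zero.2 hM
  rw [logLikelihood, Finset.sum_congr rfl fun i _ =>
    log_singlePhaseModel_gaussianKernel hσ hD hD₀ hdiam (hx i) hφ]
  simp only [truncatedLogLikelihood, Finset.sum_add_distrib, Finset.sum_sub_distrib,
    ← Finset.sum_mul, Finset.sum_const, Finset.card_univ, Fintype.card_fin, nsmul_eq_mul]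
  field_simp

lemma isFMPE_gaussianKernel_iff (hσ : σ ≠ 0) (hD : MeasurableSet D) (hD₀ : volume D ≠ 0)
    (hdiam : ∀ x ∈ D, ∀ y ∈ D, |x - y| ≤ π) {M : ℕ} (hM : M ≠ 0) {x : Fin M → ℝ}
    (hx : ∀ i, x i ∈ D) {φ : ℝ} :
    IsFMPE (gaussianKernel σ) D x φ ↔
      φ ∈ D ∧ IsMaxOn (truncatedLogLikelihood (σ ^ 2) D (1 / (M : ℝ) * ∑ i, x i)) D φ := by
  refine and_congr_right fun hφ => forall₂_congr fun φ' hφ' => ?_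
  simp only [mem_ofPred_eq]
  rw [logLikelihood_gaussianKernel hσ hD hD₀ hdiam hM hx hφ,
    logLikelihood_gaussianKernel hσ hD hD₀ hdiam hM hx hφ', add_le_add_iff_left]

end Kernel

/-! ### The outcome law on the filter interval -/

section OutcomeLaw

variable {H : Type*} [NormedAddCommGroup H] [InnerProductSpace ℂ H] {U : H ≃ₗᵢ[ℂ] H}
  {ι : Type*} [Fintype ι] {E : EigenDecomposition U ι} {ψ : H} {j₀ : ι} {σ : ℝ≥0}

lemma EigenDecomposition.weight_nonneg (E : EigenDecomposition U ι) (ψ : H) (j : ι) :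
    0 ≤ E.weight ψ j := sq_nonneg _

lemma EigenDecomposition.sum_weight (E : EigenDecomposition U ι) (hψ : ‖ψ‖ = 1) :
    ∑ j, E.weight ψ j = 1 := by
  simp only [weight, E.basis.sum_sq_norm_inner_right, hψ, one_pow]

lemma EigenDecomposition.weight_le_one (E : EigenDecomposition U ι) (hψ : ‖ψ‖ = 1) (j : ι) :
    E.weight ψ j ≤ 1 := by
  rw [← E.sum_weight hψ]
  exact Finset.single_le_sum (f := E.weight ψ) (fun i _ => E.weight_nonneg ψ i) (Finset.mem_univ j)

/-- The weight that the outcome law puts on the normal law around the target phase, relative to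
the unperiodized normal law. -/
def EigenDecomposition.targetWeight (E : EigenDecomposition U ι) (ψ : H) (j₀ : ι) (σ : ℝ≥0) :
    ℝ≥0 :=
  (E.weight ψ j₀ / circleMass σ).toNNReal

lemma EigenDecomposition.coe_targetWeight (E : EigenDecomposition U ι) (ψ : H) (j₀ : ι)
    (hσ : σ ≠ 0) : (E.targetWeight ψ j₀ σ : ℝ) = E.weight ψ j₀ / circleMass σ :=
  Real.coe_toNNReal _ (div_nonneg (E.weight_nonneg ψ j₀) (circleMass_pos hσ).le)

lemma EigenDecomposition.weight_le_targetWeight (E : EigenDecomposition U ι) (ψ : H) (j₀ : ι)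
    (hσ : σ ≠ 0) : E.weight ψ j₀ ≤ E.targetWeight ψ j₀ σ := by
  rw [E.coe_targetWeight ψ j₀ hσ]
  exact le_div_self (E.weight_nonneg ψ j₀) (circleMass_pos hσ) (circleMass_le_one σ)

lemma EigenDecomposition.targetWeight_ne_zero (E : EigenDecomposition U ι) (hσ : σ ≠ 0)
    (hw : 0 < E.weight ψ j₀) : E.targetWeight ψ j₀ σ ≠ 0 :=
  NNReal.coe_ne_zero.1 (hw.trans_le (E.weight_le_targetWeight ψ j₀ hσ)).ne'

lemma EigenDecomposition.sum_erase_weight_mul_le [DecidableEq ι] (E : EigenDecomposition U ι)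
    (hψ : ‖ψ‖ = 1) {f : ι → ℝ} {R : ℝ} (hR : 0 ≤ R) (hf : ∀ j, j ≠ j₀ → f j ≤ R) :
    ∑ j ∈ Finset.univ.erase j₀, E.weight ψ j * f j ≤ R :=
  calc ∑ j ∈ Finset.univ.erase j₀, E.weight ψ j * f j
      ≤ ∑ j ∈ Finset.univ.erase j₀, E.weight ψ j * R :=
        Finset.sum_le_sum fun j hj => mul_le_mul_of_nonneg_left
          (hf j (Finset.ne_of_mem_erase hj)) (E.weight_nonneg ψ j)
    _ ≤ ∑ j, E.weight ψ j * R :=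
        Finset.sum_le_sum_of_subset_of_nonneg (Finset.erase_subset _ _)
          fun j _ _ => mul_nonneg (E.weight_nonneg ψ j) hR
    _ = R := by rw [← Finset.sum_mul, E.sum_weight hψ, one_mul]

lemma EigenDecomposition.ofReal_weight_mul_gaussianKernel (E : EigenDecomposition U ι) (ψ : H)
    (hσ : σ ≠ 0) {x : ℝ} (hx : |x - E.phase j₀| ≤ π) :
    ENNReal.ofReal (E.weight ψ j₀ * gaussianKernel σ (x - E.phase j₀)) =
      E.targetWeight ψ j₀ σ * gaussianPDF (E.phase j₀) (σ ^ 2) x := by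
  rw [gaussianKernel_sub_of_abs_le hσ hx, mul_div_left_comm, mul_comm,
    ENNReal.ofReal_mul (div_nonneg (E.weight_nonneg ψ j₀) (circleMass_pos hσ).le)]
  rfl

lemma EigenDecomposition.exists_outcomeLaw_restrict_eq (E : EigenDecomposition U ι)
    (hσ : σ ≠ 0) (hψ : ‖ψ‖ = 1) {D : Set ℝ} (hD : MeasurableSet D) (hsub : D ⊆ Ico 0 (2 * π))
    (hnear : ∀ x ∈ D, |x - E.phase j₀| ≤ π) {d : ℝ} (hd : 0 ≤ d)
    (hfar : ∀ x ∈ D, ∀ j, j ≠ j₀ → ∀ n : ℤ, d ≤ |x - E.phase j - n * (2 * π)|) :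
    ∃ ν : Measure ℝ,
      (E.outcomeLaw ψ (gaussianKernel σ)).restrict D =
        E.targetWeight ψ j₀ σ • (gaussianReal (E.phase j₀) (σ ^ 2)).restrict D + ν ∧
      ν univ ≤ ENNReal.ofReal (gaussianPDFReal 0 (σ ^ 2) d / circleMass σ) * volume D := by
  classical
  let rest : ℝ → ℝ := fun x =>
    ∑ j ∈ Finset.univ.erase j₀, E.weight ψ j * gaussianKernel σ (x - E.phase j)
  have hrest : Measurable fun x => ENNReal.ofReal (rest x) :=
    (Finset.measurable_fun_sum _ fun j _ =>
      ((measurable_gaussianKernel _).comp (measurable_id.sub_const _)).const_mul _).ennreal_ofReal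
  have hterm (j : ι) (x : ℝ) : 0 ≤ E.weight ψ j * gaussianKernel σ (x - E.phase j) :=
    mul_nonneg (E.weight_nonneg ψ j) (gaussianKernel_nonneg hσ _)
  have hdens : ∀ x ∈ D, ENNReal.ofReal (∑ j, E.weight ψ j * gaussianKernel σ (x - E.phase j)) =
      E.targetWeight ψ j₀ σ * gaussianPDF (E.phase j₀) (σ ^ 2) x + ENNReal.ofReal (rest x) := by
    intro x hx
    rw [← E.ofReal_weight_mul_gaussianKernel ψ hσ (hnear x hx),
      ← ENNReal.ofReal_add (hterm j₀ x) (Finset.sum_nonneg fun j _ => hterm j x),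
      Finset.add_sum_erase _ (fun j => E.weight ψ j * gaussianKernel σ (x - E.phase j))
        (Finset.mem_univ j₀)]
  refine ⟨(volume.restrict D).withDensity fun x => ENNReal.ofReal (rest x), ?_, ?_⟩
  · rw [outcomeLaw, restrict_withDensity hD, Measure.restrict_restrict hD, inter_eq_left.2 hsub,
      withDensity_congr_ae ((ae_restrict_iff' hD).2 (.of_forall hdens)),
      gaussianReal_of_var_ne_zero _ (pow_ne_zero 2 hσ), restrict_withDensity hD]
    exact (withDensity_add_right _ hrest).trans (congrArg (· + _)
      (withDensity_smul _ (measurable_gaussianPDF _ _)))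
  · rw [withDensity_apply _ .univ, Measure.restrict_univ, ← setLIntegral_const]
    refine setLIntegral_mono' hD fun x hx => ENNReal.ofReal_le_ofReal ?_
    exact E.sum_erase_weight_mul_le hψ
      (div_nonneg (gaussianPDFReal_nonneg _ _ _) (circleMass_pos hσ).le)
      fun j hj => gaussianKernel_le_of_forall_le_abs hσ hd (hfar x hx j hj)

lemma volume_filterInterval (g Δ : ℝ) : volume (filterInterval g Δ) = ENNReal.ofReal Δ := by
  rw [filterInterval, Real.volume_Icc]
  ring_nf

/-- The target phase `φ_{j₀}` is separated by more than `Δ` from the other phases and roughly known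
to be near `g`, and the filter interval around `g` does not wrap around the circle. -/
structure EigenDecomposition.IsIsolated (E : EigenDecomposition U ι) (j₀ : ι) (g Δ : ℝ) :
    Prop where
  gap : ∀ j, j ≠ j₀ → Δ < |E.phase j - E.phase j₀|
  guess : |E.phase j₀ - g| < Δ / 3
  subset : filterInterval g Δ ⊆ Ico (Δ / 6) (2 * π - Δ / 6)

namespace EigenDecomposition.IsIsolated

variable {g Δ x : ℝ}

lemma pos (h : E.IsIsolated j₀ g Δ) : 0 < Δ := by linarith [abs_nonneg (E.phase j₀ - g), h.guess]

lemma abs_sub_phase_le (h : E.IsIsolated j₀ g Δ) (hx : x ∈ filterInterval g Δ) :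
    |x - E.phase j₀| ≤ 5 / 6 * Δ := by
  obtain ⟨hg₁, hg₂⟩ := abs_lt.1 h.guess
  exact abs_le.2 ⟨by linarith [hx.1], by linarith [hx.2]⟩

lemma phase_mem_filterInterval (h : E.IsIsolated j₀ g Δ) :
    E.phase j₀ ∈ filterInterval g Δ := by
  obtain ⟨hg₁, hg₂⟩ := abs_lt.1 h.guess
  exact ⟨by linarith [h.pos], by linarith [h.pos]⟩

lemma le_abs_sub_sub_int_mul_two_pi (h : E.IsIsolated j₀ g Δ)
    (hx : x ∈ filterInterval g Δ) {j : ι} (hj : j ≠ j₀) (n : ℤ) :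
    Δ / 6 ≤ |x - E.phase j - n * (2 * π)| := by
  obtain ⟨hlow, hupp⟩ := h.subset hx
  obtain ⟨hj₀, hj₂⟩ := E.phase_mem j
  rcases lt_trichotomy n 0 with hn | rfl | hn
  · have hn' : (n : ℝ) ≤ -1 := by exact_mod_cast Int.le_sub_one_of_lt hn
    refine le_trans ?_ (le_abs_self _)
    nlinarith [pi_pos]
  · have htri := abs_sub_le (E.phase j) x (E.phase j₀)
    rw [Int.cast_zero, zero_mul, sub_zero, abs_sub_comm]
    linarith [h.gap j hj, h.abs_sub_phase_le hx]
  · have hn' : (1 : ℝ) ≤ n := by exact_mod_cast hn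
    refine le_trans ?_ (neg_le_abs _)
    nlinarith [pi_pos]

lemma exists_outcomeLaw_restrict_eq (h : E.IsIsolated j₀ g Δ) (hσ : σ ≠ 0) (hψ : ‖ψ‖ = 1)
    (hΔ : Δ ≤ π) :
    ∃ ν : Measure ℝ,
      (E.outcomeLaw ψ (gaussianKernel σ)).restrict (filterInterval g Δ) =
        E.targetWeight ψ j₀ σ •
          (gaussianReal (E.phase j₀) (σ ^ 2)).restrict (filterInterval g Δ) + ν ∧
      ν.real univ ≤ gaussianPDFReal 0 (σ ^ 2) (Δ / 6) / circleMass σ * Δ := by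
  have hΔ₀ := h.pos
  obtain ⟨ν, hν, hmass⟩ := E.exists_outcomeLaw_restrict_eq (j₀ := j₀) (D := filterInterval g Δ)
    hσ hψ measurableSet_Icc
    (h.subset.trans (Ico_subset_Ico (by positivity) (by linarith)))
    (fun x hx => (h.abs_sub_phase_le hx).trans (by linarith)) (by positivity : 0 ≤ Δ / 6)
    fun x hx j hj n => h.le_abs_sub_sub_int_mul_two_pi hx hj n
  have hR : 0 ≤ gaussianPDFReal 0 (σ ^ 2) (Δ / 6) / circleMass σ :=
    div_nonneg (gaussianPDFReal_nonneg _ _ _) (circleMass_pos hσ).le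
  rw [volume_filterInterval, ← ENNReal.ofReal_mul hR] at hmass
  exact ⟨ν, hν, ENNReal.toReal_le_of_le_ofReal (by positivity) hmass⟩

end EigenDecomposition.IsIsolated

end OutcomeLaw

/-! ### The error of the estimator -/

section Error

variable {σ : ℝ≥0} {a b : ℝ} {M : ℕ}

lemma isFMPE_gaussianKernel_Icc_iff (hσ : σ ≠ 0) (hab : a < b) (hlen : b - a ≤ π) (hM : M ≠ 0)
    {x : Fin M → ℝ} (hx : ∀ i, x i ∈ Icc a b) {φ : ℝ} :
    IsFMPE (gaussianKernel σ) (Icc a b) x φ ↔ φ ∈ Icc a b ∧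
      IsMaxOn (truncatedLogLikelihood (σ ^ 2) (Icc a b) (1 / (M : ℝ) * ∑ i, x i)) (Icc a b) φ :=
  isFMPE_gaussianKernel_iff hσ measurableSet_Icc (by simpa using hab)
    (fun _ hx _ hy => (abs_sub_le_of_le_of_le hx.1 hx.2 hy.1 hy.2).trans hlen) hM hx

lemma exists_continuous_isFMPE_iff (hσ : σ ≠ 0) (hab : a < b) (hlen : b - a ≤ π) :
    ∃ F : ℝ → ℝ, Continuous F ∧ ∀ {M : ℕ}, M ≠ 0 → ∀ {x : Fin M → ℝ}, (∀ i, x i ∈ Icc a b) →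
      ∀ {φ : ℝ}, IsFMPE (gaussianKernel σ) (Icc a b) x φ ↔ φ = F (1 / (M : ℝ) * ∑ i, x i) := by
  have hσ₀ : (0 : ℝ) < σ := by positivity
  have hvol : volume (Icc a b) ≠ 0 := by simpa using hab
  have : 0 < min (σ : ℝ) (b - a) := lt_min hσ₀ (sub_pos.2 hab)
  obtain ⟨F, hF, hmax⟩ := exists_continuous_isMaxOn_iff (pow_ne_zero 2 hσ) isCompact_Icc hvol
    (convex_Icc a b) (c := min (σ : ℝ) (b - a) ^ 3 / (384 * σ) / σ ^ 2) (by positivity)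
    fun ξ hξ => by
      rw [NNReal.coe_pow]
      gcongr
      exact cube_div_le_variance_cond_gaussianReal hσ hab hξ
  exact ⟨F, hF, fun hM _ hx _ =>
    (isFMPE_gaussianKernel_Icc_iff hσ hab hlen hM hx).trans (hmax _ _)⟩

lemma existsUnique_isFMPE (hσ : σ ≠ 0) (hab : a < b) (hlen : b - a ≤ π) (hM : M ≠ 0)
    {x : Fin M → ℝ} (hx : ∀ i, x i ∈ Icc a b) :
    ∃! φ, IsFMPE (gaussianKernel σ) (Icc a b) x φ := by
  obtain ⟨F, -, hF⟩ := exists_continuous_isFMPE_iff hσ hab hlen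
  simp only [hF hM hx, existsUnique_eq]

variable {P : Measure ℝ} [IsProbabilityMeasure P] {est : (Fin M → ℝ) → ℝ}

lemma ae_pi_forall_mem {D : Set ℝ} (hP : ∀ᵐ y ∂P, y ∈ D) :
    ∀ᵐ x ∂Measure.pi fun _ : Fin M => P, ∀ i, x i ∈ D :=
  ae_all_iff.2 fun _ => Measure.tendsto_eval_ae_ae.eventually hP

lemma ae_pi_estimate_mem {f : ℝ → ℝ} {D : Set ℝ} (hP : ∀ᵐ y ∂P, y ∈ D)
    (hest : ∀ x : Fin M → ℝ, (∀ i, x i ∈ D) → IsFMPE f D x (est x)) :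
    ∀ᵐ x ∂Measure.pi fun _ : Fin M => P, est x ∈ D := by
  filter_upwards [ae_pi_forall_mem hP] with x hx using (hest x hx).1

lemma aestronglyMeasurable_estimate (hσ : σ ≠ 0) (hab : a < b) (hlen : b - a ≤ π) (hM : M ≠ 0)
    (hP : ∀ᵐ y ∂P, y ∈ Icc a b)
    (hest : ∀ x : Fin M → ℝ, (∀ i, x i ∈ Icc a b) →
      IsFMPE (gaussianKernel σ) (Icc a b) x (est x)) :
    AEStronglyMeasurable est (Measure.pi fun _ => P) := by
  obtain ⟨F, hF, hiff⟩ := exists_continuous_isFMPE_iff hσ hab hlen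
  have hmeas : Measurable fun x : Fin M → ℝ => F (1 / (M : ℝ) * ∑ i, x i) := by fun_prop
  refine hmeas.aestronglyMeasurable.congr ?_
  filter_upwards [ae_pi_forall_mem hP] with x hx using ((hiff hM hx).1 (hest x hx)).symm

lemma integrable_sq_estimate_sub (hσ : σ ≠ 0) (hab : a < b) (hlen : b - a ≤ π) (hM : M ≠ 0)
    (hP : ∀ᵐ y ∂P, y ∈ Icc a b)
    (hest : ∀ x : Fin M → ℝ, (∀ i, x i ∈ Icc a b) →
      IsFMPE (gaussianKernel σ) (Icc a b) x (est x)) (φ₀ : ℝ) :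
    Integrable (fun x => (est x - φ₀) ^ 2) (Measure.pi fun _ => P) := by
  have hbound : ∀ᵐ x ∂Measure.pi fun _ : Fin M => P, ‖est x‖ ≤ max |a| |b| := by
    filter_upwards [ae_pi_estimate_mem hP hest] with x hx
    exact abs_le_max_abs_abs hx.1 hx.2
  have hmem : MemLp est 2 (Measure.pi fun _ => P) :=
    .of_bound (aestronglyMeasurable_estimate hσ hab hlen hM hP hest) _ hbound
  exact (hmem.sub (memLp_const φ₀)).integrable_sq

lemma integral_sq_estimate_sub_le_of_forall_abs_sub_le (hσ : σ ≠ 0) (hab : a < b)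
    (hlen : b - a ≤ π) (hM : M ≠ 0) (hP : ∀ᵐ y ∂P, y ∈ Icc a b)
    (hest : ∀ x : Fin M → ℝ, (∀ i, x i ∈ Icc a b) →
      IsFMPE (gaussianKernel σ) (Icc a b) x (est x))
    {φ₀ r : ℝ} (hr : ∀ φ ∈ Icc a b, |φ - φ₀| ≤ r) :
    ∫ x, (est x - φ₀) ^ 2 ∂Measure.pi (fun _ => P) ≤ r ^ 2 := by
  have hae : ∀ᵐ x ∂Measure.pi fun _ : Fin M => P, (est x - φ₀) ^ 2 ≤ r ^ 2 := by
    filter_upwards [ae_pi_estimate_mem hP hest] with x hx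
    exact sq_le_sq' (abs_le.1 (hr _ hx)).1 (abs_le.1 (hr _ hx)).2
  simpa using integral_mono_ae (integrable_sq_estimate_sub hσ hab hlen hM hP hest φ₀)
    (integrable_const (r ^ 2)) hae

lemma sq_mul_integral_sq_estimate_sub_le (hσ : σ ≠ 0) (hab : a < b) (hlen : b - a ≤ π)
    (hM : M ≠ 0) (hP : ∀ᵐ y ∂P, y ∈ Icc a b)
    (hest : ∀ x : Fin M → ℝ, (∀ i, x i ∈ Icc a b) →
      IsFMPE (gaussianKernel σ) (Icc a b) x (est x))
    {φ₀ c : ℝ} (hφ₀ : φ₀ ∈ Icc a b) (hc₀ : 0 ≤ c)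
    (hc : ∀ ξ ∈ Icc a b, c ≤ Var[id; (gaussianReal ξ (σ ^ 2))[|Icc a b]] / σ ^ 2) :
    c ^ 2 * ∫ x, (est x - φ₀) ^ 2 ∂Measure.pi (fun _ => P) ≤
      Var[id; P] / M + (∫ y, y ∂P - truncatedMean (σ ^ 2) (Icc a b) φ₀) ^ 2 := by
  have hmem : MemLp id 2 P := memLp_of_bounded hP aestronglyMeasurable_id _
  obtain ⟨hinteg, hmean⟩ :=
    integral_sq_empiricalMean_sub hmem hM (truncatedMean (σ ^ 2) (Icc a b) φ₀)
  rw [← hmean, ← integral_const_mul]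
  refine integral_mono_ae
    ((integrable_sq_estimate_sub hσ hab hlen hM hP hest φ₀).const_mul _) hinteg ?_
  filter_upwards [ae_pi_forall_mem hP] with x hx
  obtain ⟨hmemD, hmax⟩ := (isFMPE_gaussianKernel_Icc_iff hσ hab hlen hM hx).1 (hest x hx)
  have hlip := mul_abs_sub_le_abs_sub_truncatedMean (pow_ne_zero 2 hσ) measurableSet_Icc
    (by simpa using hab) (convex_Icc a b) hmemD hφ₀ hc hmax
  simpa only [mul_pow, sq_abs] using pow_le_pow_left₀ (by positivity) hlip 2

end Error

/-! ### Numerical bounds -/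

section Numerics

lemma le_mul_exp_of_mul_sqrt_log_le {κ k Δ η ε σ t : ℝ} (hκ : 0 < κ) (hk : 0 < k) (hΔ : 0 < Δ)
    (hη : 0 < η) (hε : 0 < ε) (hσ : 0 < σ) (htσ : t * σ ≤ κ)
    (ht : k * κ * Δ⁻¹ * √(log (Δ * ε⁻¹ * η⁻¹)) ≤ t) :
    Δ ≤ ε * η * exp ((Δ / (k * σ)) ^ 2) := by
  have hsqrt : √(log (Δ * ε⁻¹ * η⁻¹)) ≤ Δ / (k * σ) := by
    rw [le_div_iff₀ (by positivity)]
    refine le_of_mul_le_mul_left ?_ (by positivity : 0 < κ * Δ⁻¹)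
    calc κ * Δ⁻¹ * (√(log (Δ * ε⁻¹ * η⁻¹)) * (k * σ))
        = k * κ * Δ⁻¹ * √(log (Δ * ε⁻¹ * η⁻¹)) * σ := by ring
      _ ≤ t * σ := by gcongr
      _ ≤ κ := htσ
      _ = κ * Δ⁻¹ * Δ := by field_simp
  have hlog := (log_le_iff_le_exp (by positivity)).1 (sqrt_le_iff.1 hsqrt).2
  calc Δ = ε * η * (Δ * ε⁻¹ * η⁻¹) := by field_simp
    _ ≤ _ := by gcongr

lemma four_mul_cube_le_exp {u : ℝ} (hu : 500 ≤ u) : 4 * u ^ 3 ≤ exp (u ^ 2 / 144) := by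
  have hexp : (u ^ 2 / 144) ^ 3 / 6 ≤ exp (u ^ 2 / 144) := by
    simpa [Nat.factorial] using pow_div_factorial_le_exp (u ^ 2 / 144) (by positivity) 3
  refine le_trans ?_ hexp
  have hu3 : (500 : ℝ) ^ 3 ≤ u ^ 3 := by gcongr
  nlinarith [pow_nonneg (by linarith : 0 ≤ u) 3]

lemma gaussianPDFReal_zero_le {σ : ℝ≥0} (hσ : σ ≠ 0) (x : ℝ) :
    gaussianPDFReal 0 (σ ^ 2) x ≤ exp (-x ^ 2 / (2 * σ ^ 2)) / (2 * σ) := by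
  have : (0 : ℝ) < σ := by positivity
  have hsqrt : 2 * (σ : ℝ) ≤ √(2 * π * σ ^ 2) := by
    apply le_sqrt_of_sq_le
    nlinarith [pi_gt_three]
  rw [gaussianPDFReal, sub_zero, NNReal.coe_pow, inv_mul_eq_div]
  gcongr

lemma gaussianPDFReal_mul_le_of_le_mul_exp {σ : ℝ≥0} {Δ ε η : ℝ} (hσ : σ ≠ 0) (hε : 0 < ε)
    (hη : 0 < η) (hnarrow : 500 * σ ≤ Δ) (hexp : Δ ≤ ε * η * exp ((Δ / (2000 * σ)) ^ 2)) :
    8 * (gaussianPDFReal 0 (σ ^ 2) (Δ / 6) * Δ) ≤ η * (ε * σ ^ 2 / Δ ^ 3) := by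
  have hσ₀ : (0 : ℝ) < σ := by positivity
  have hΔ : 0 < Δ := lt_of_lt_of_le (by positivity) hnarrow
  set u := Δ / σ with hu
  have hΔu : Δ = u * σ := by rw [hu]; field_simp
  have hu₀ : 0 < u := by positivity
  have hdecay : 4 * u ^ 3 * exp (-(u ^ 2 / 72)) ≤ exp (-(u ^ 2 / 144)) := by
    calc 4 * u ^ 3 * exp (-(u ^ 2 / 72)) ≤ exp (u ^ 2 / 144) * exp (-(u ^ 2 / 72)) := by
          gcongr
          exact four_mul_cube_le_exp ((le_div_iff₀ hσ₀).2 hnarrow)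
      _ = exp (-(u ^ 2 / 144)) := by rw [← exp_add]; ring_nf
  have hoverlap : Δ * exp (-(u ^ 2 / 144)) ≤ ε * η := by
    calc Δ * exp (-(u ^ 2 / 144)) ≤ ε * η * exp (u ^ 2 / 144) * exp (-(u ^ 2 / 144)) := by
          gcongr
          refine hexp.trans ?_
          gcongr
          rw [hΔu, mul_div_mul_right _ _ hσ₀.ne', div_pow]
          gcongr
          norm_num
      _ = ε * η := by rw [mul_assoc, ← exp_add]; simp
  calc 8 * (gaussianPDFReal 0 (σ ^ 2) (Δ / 6) * Δ)
      ≤ 8 * (exp (-(Δ / 6) ^ 2 / (2 * σ ^ 2)) / (2 * σ) * Δ) := by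
        gcongr
        exact gaussianPDFReal_zero_le hσ _
    _ = 4 * u ^ 3 * exp (-(u ^ 2 / 72)) / u ^ 2 := by
        have : -(Δ / 6) ^ 2 / (2 * (σ : ℝ) ^ 2) = -(u ^ 2 / 72) := by rw [hΔu]; field_simp; norm_num
        rw [this, hΔu]
        field_simp
        norm_num
    _ ≤ exp (-(u ^ 2 / 144)) / u ^ 2 := by gcongr
    _ = Δ * exp (-(u ^ 2 / 144)) * σ ^ 2 / Δ ^ 3 := by rw [hΔu]; field_simp
    _ ≤ ε * η * σ ^ 2 / Δ ^ 3 := by gcongr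
    _ = η * (ε * σ ^ 2 / Δ ^ 3) := by ring

lemma mul_le_of_le_mul_exp {σ Δ ε η : ℝ} (hσ : 0 < σ) (hΔ : 0 < Δ) (hη : η ≤ 1) (hε : 0 < ε)
    (hwide : Δ ≤ 500 * σ) (hexp : Δ ≤ ε * η * exp ((Δ / (2000 * σ)) ^ 2)) : 5 / 6 * Δ ≤ ε := by
  have hratio : Δ / (2000 * σ) ≤ 1 / 4 := by
    rw [div_le_iff₀ (by positivity)]
    linarith
  have hexp' : exp ((Δ / (2000 * σ)) ^ 2) ≤ 6 / 5 :=
    calc exp ((Δ / (2000 * σ)) ^ 2) ≤ exp ((1 / 4) ^ 2) := by gcongr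
      _ ≤ 1 / (1 - (1 / 4) ^ 2) := exp_bound_div_one_sub_of_interval (by norm_num) (by norm_num)
      _ ≤ 6 / 5 := by norm_num
  have : Δ ≤ ε * 1 * (6 / 5) := hexp.trans (by gcongr)
  linarith

-- For `Δ < 500σ` a single sample suffices, since every point of the filter interval is then
-- within `ε` of the target.
lemma exists_sampleSize {σ Δ ε : ℝ} (hσ : 0 < σ) (hε : 0 < ε) (hεΔ : ε ≤ Δ) :
    ∃ M : ℕ, M ≠ 0 ∧ (500 * σ ≤ Δ → 3000000 * σ ^ 2 ≤ M * ε ^ 2) ∧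
      M * (σ / min σ Δ) ≤ 3000000 * σ ^ 2 / ε ^ 2 + 1 := by
  by_cases hnarrow : 500 * σ ≤ Δ
  · refine ⟨⌈3000000 * σ ^ 2 / ε ^ 2⌉₊, (Nat.ceil_pos.2 (by positivity)).ne', fun _ => ?_, ?_⟩
    · rw [← div_le_iff₀ (by positivity)]
      exact Nat.le_ceil _
    · rw [min_eq_left (by linarith), div_self hσ.ne', mul_one]
      exact (Nat.ceil_lt_add_one (by positivity)).le
  · refine ⟨1, one_ne_zero, fun h => absurd h hnarrow, ?_⟩
    have hsq : 0 ≤ σ ^ 2 / ε ^ 2 := by positivity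
    rw [Nat.cast_one, one_mul, mul_div_assoc]
    rcases le_total σ Δ with hσΔ | hΔσ
    · rw [min_eq_left hσΔ, div_self hσ.ne']
      linarith
    · have hΔ : 0 < Δ := hε.trans_le hεΔ
      have : σ / Δ ≤ σ ^ 2 / ε ^ 2 := by
        rw [div_le_div_iff₀ hΔ (by positivity)]
        calc σ * ε ^ 2 ≤ σ * (σ * Δ) := by rw [sq]; gcongr; linarith
          _ = σ ^ 2 * Δ := by ring
      rw [min_eq_right hΔσ]
      linarith

lemma mul_sq_div_sq_add_one_le {κ B K ε σ t : ℝ} (hK : 0 ≤ K) (hε : 0 < ε) (hσ : 0 ≤ σ)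
    (ht : 0 < t) (htσ : t * σ ≤ κ) (htε : t * ε ≤ B) :
    K * σ ^ 2 / ε ^ 2 + 1 ≤ (K * κ ^ 2 + B ^ 2) * (t ^ 2)⁻¹ * (ε ^ 2)⁻¹ :=
  calc K * σ ^ 2 / ε ^ 2 + 1
      = (K * (t * σ) ^ 2 + (t * ε) ^ 2) * (t ^ 2)⁻¹ * (ε ^ 2)⁻¹ := by field_simp
    _ ≤ _ := by gcongr

end Numerics

/-! ### Guarantees for an isolated phase -/

namespace EigenDecomposition.IsIsolated

variable {H : Type*} [NormedAddCommGroup H] [InnerProductSpace ℂ H] {U : H ≃ₗᵢ[ℂ] H}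
  {ι : Type*} [Fintype ι] {E : EigenDecomposition U ι} {ψ : H} {j₀ : ι} {σ : ℝ≥0}
  {g Δ ε η : ℝ} {M : ℕ}

lemma div_le_gaussianReal_filterInterval (h : E.IsIsolated j₀ g Δ) (hσ : σ ≠ 0) :
    min (σ : ℝ) Δ / (8 * σ) ≤
      (gaussianReal (E.phase j₀) (σ ^ 2)).real (filterInterval g Δ) := by
  have hmass := div_le_gaussianReal_Icc hσ h.phase_mem_filterInterval
  rwa [show g + Δ / 2 - (g - Δ / 2) = Δ by ring] at hmass

lemma ofReal_weight_mul_le_outcomeLaw (h : E.IsIsolated j₀ g Δ) (hσ : σ ≠ 0) (hψ : ‖ψ‖ = 1)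
    (hΔ : Δ ≤ π) :
    ENNReal.ofReal (E.weight ψ j₀ * (min (σ : ℝ) Δ / (8 * σ))) ≤
      E.outcomeLaw ψ (gaussianKernel σ) (filterInterval g Δ) := by
  obtain ⟨ν, hν, -⟩ := h.exists_outcomeLaw_restrict_eq hσ hψ hΔ
  set D := filterInterval g Δ
  set G := gaussianReal (E.phase j₀) (σ ^ 2)
  have hmin : 0 ≤ min (σ : ℝ) Δ := le_min (by positivity) h.pos.le
  calc ENNReal.ofReal (E.weight ψ j₀ * (min (σ : ℝ) Δ / (8 * σ)))
      ≤ ENNReal.ofReal (E.targetWeight ψ j₀ σ * G.real D) := by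
        gcongr ENNReal.ofReal ?_
        exact mul_le_mul (E.weight_le_targetWeight ψ j₀ hσ)
          (h.div_le_gaussianReal_filterInterval hσ) (div_nonneg hmin (by positivity))
          (by positivity)
    _ = (E.targetWeight ψ j₀ σ • G.restrict D) D := by
        rw [ENNReal.ofReal_mul (by positivity), ENNReal.ofReal_coe_nnreal, ofReal_measureReal,
          Measure.smul_apply, Measure.restrict_apply_self, ENNReal.smul_def, smul_eq_mul]
    _ ≤ (E.outcomeLaw ψ (gaussianKernel σ)).restrict D D := by
        rw [hν]
        exact le_self_add
    _ = _ := Measure.restrict_apply_self _ _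

lemma outcomeLaw_filterInterval_ne_zero (h : E.IsIsolated j₀ g Δ) (hσ : σ ≠ 0) (hψ : ‖ψ‖ = 1)
    (hΔ : Δ ≤ π) (hw : 0 < E.weight ψ j₀) :
    E.outcomeLaw ψ (gaussianKernel σ) (filterInterval g Δ) ≠ 0 := by
  have hmin : 0 < min (σ : ℝ) Δ := lt_min (by positivity) h.pos
  have hpos : 0 < E.weight ψ j₀ * (min (σ : ℝ) Δ / (8 * σ)) := by positivity
  exact ((ENNReal.ofReal_pos.2 hpos).trans_le (h.ofReal_weight_mul_le_outcomeLaw hσ hψ hΔ)).ne'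

lemma gaussianReal_filterInterval_ne_zero (h : E.IsIsolated j₀ g Δ) (hσ : σ ≠ 0) :
    gaussianReal (E.phase j₀) (σ ^ 2) (filterInterval g Δ) ≠ 0 :=
  gaussianReal_apply_ne_zero (pow_ne_zero 2 hσ) _ <| by
    rw [volume_filterInterval]
    exact (ENNReal.ofReal_pos.2 h.pos).ne'

lemma one_eighth_le_gaussianReal_filterInterval (h : E.IsIsolated j₀ g Δ) (hσ : σ ≠ 0)
    (hσΔ : σ ≤ Δ) :
    1 / 8 ≤ (gaussianReal (E.phase j₀) (σ ^ 2)).real (filterInterval g Δ) := by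
  have : (0 : ℝ) < σ := by positivity
  refine le_of_eq_of_le ?_ (h.div_le_gaussianReal_filterInterval hσ)
  rw [min_eq_left hσΔ]
  field_simp

lemma exists_outcomeLaw_restrict_eq_of_narrow (h : E.IsIsolated j₀ g Δ) (hσ : σ ≠ 0)
    (hψ : ‖ψ‖ = 1) (hΔ : Δ ≤ π) (hε : 0 < ε) (hη : 0 < η) (hw : η ≤ E.weight ψ j₀)
    (hnarrow : 500 * σ ≤ Δ) (hexp : Δ ≤ ε * η * exp ((Δ / (2000 * σ)) ^ 2)) :
    ∃ ν : Measure ℝ,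
      (E.outcomeLaw ψ (gaussianKernel σ)).restrict (filterInterval g Δ) =
        E.targetWeight ψ j₀ σ •
          (gaussianReal (E.phase j₀) (σ ^ 2)).restrict (filterInterval g Δ) + ν ∧
      ν.real univ / (E.targetWeight ψ j₀ σ *
        (gaussianReal (E.phase j₀) (σ ^ 2)).real (filterInterval g Δ)) ≤ ε * σ ^ 2 / Δ ^ 3 := by
  obtain ⟨ν, hν, hmass⟩ := h.exists_outcomeLaw_restrict_eq (ψ := ψ) hσ hψ hΔ
  refine ⟨ν, hν, ?_⟩
  have hΔ₀ := h.pos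
  have hZ := circleMass_pos hσ
  have hσ₀ : (0 : ℝ) < σ := by positivity
  set m := (gaussianReal (E.phase j₀) (σ ^ 2)).real (filterInterval g Δ)
  have hm : 1 / 8 ≤ m := h.one_eighth_le_gaussianReal_filterInterval hσ (by linarith)
  have : 0 < m := by linarith
  have hw₀ : 0 < E.weight ψ j₀ := hη.trans_le hw
  have hpdf := gaussianPDFReal_nonneg 0 (σ ^ 2) (Δ / 6)
  calc ν.real univ / (E.targetWeight ψ j₀ σ * m)
      ≤ gaussianPDFReal 0 (σ ^ 2) (Δ / 6) / circleMass σ * Δ /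
          (E.weight ψ j₀ / circleMass σ * m) := by
        rw [E.coe_targetWeight ψ j₀ hσ]
        gcongr
    _ = gaussianPDFReal 0 (σ ^ 2) (Δ / 6) * Δ / (E.weight ψ j₀ * m) := by field_simp
    _ ≤ gaussianPDFReal 0 (σ ^ 2) (Δ / 6) * Δ / (η * (1 / 8)) := by gcongr
    _ = 8 * (gaussianPDFReal 0 (σ ^ 2) (Δ / 6) * Δ) / η := by field_simp
    _ ≤ ε * σ ^ 2 / Δ ^ 3 := by
        rw [div_le_iff₀ hη, mul_comm _ η]
        exact gaussianPDFReal_mul_le_of_le_mul_exp hσ hε hη hnarrow hexp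

variable [IsProbabilityMeasure (E.outcomeLaw ψ (gaussianKernel σ))]

lemma abs_integral_cond_outcomeLaw_sub_truncatedMean_le (h : E.IsIsolated j₀ g Δ) (hσ : σ ≠ 0)
    (hψ : ‖ψ‖ = 1) (hΔ : Δ ≤ π) (hε : 0 < ε) (hη : 0 < η) (hw : η ≤ E.weight ψ j₀)
    (hnarrow : 500 * σ ≤ Δ) (hexp : Δ ≤ ε * η * exp ((Δ / (2000 * σ)) ^ 2)) :
    |∫ y, y ∂(E.outcomeLaw ψ (gaussianKernel σ))[|filterInterval g Δ] -
        truncatedMean (σ ^ 2) (filterInterval g Δ) (E.phase j₀)| ≤ ε / 768 := by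
  obtain ⟨ν, hν, hratio⟩ :=
    h.exists_outcomeLaw_restrict_eq_of_narrow hσ hψ hΔ hε hη hw hnarrow hexp
  have hΔ₀ := h.pos
  have hσΔ : (500 * (σ : ℝ)) ^ 2 ≤ Δ ^ 2 := by gcongr
  have hdiff := abs_integral_cond_sub_integral_cond_le measurableSet_Icc
    (h.gaussianReal_filterInterval_ne_zero hσ) (E.targetWeight_ne_zero hσ (hη.trans_le hw)) hν
    measurable_id fun y hy => hy
  rw [show g + Δ / 2 - (g - Δ / 2) = Δ by ring] at hdiff
  calc _ ≤ Δ * (ε * σ ^ 2 / Δ ^ 3) := hdiff.trans (mul_le_mul_of_nonneg_left hratio hΔ₀.le)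
    _ = ε * σ ^ 2 / Δ ^ 2 := by field_simp
    _ ≤ ε / 768 := by
        rw [div_le_div_iff₀ (by positivity) (by norm_num)]
        nlinarith

lemma variance_cond_outcomeLaw_le (h : E.IsIsolated j₀ g Δ) (hσ : σ ≠ 0)
    (hψ : ‖ψ‖ = 1) (hΔ : Δ ≤ π) (hε : 0 < ε) (hεΔ : ε ≤ Δ) (hη : 0 < η)
    (hw : η ≤ E.weight ψ j₀) (hnarrow : 500 * σ ≤ Δ)
    (hexp : Δ ≤ ε * η * exp ((Δ / (2000 * σ)) ^ 2)) :
    Var[id; (E.outcomeLaw ψ (gaussianKernel σ))[|filterInterval g Δ]] ≤ 9 * σ ^ 2 := by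
  obtain ⟨ν, hν, hratio⟩ :=
    h.exists_outcomeLaw_restrict_eq_of_narrow hσ hψ hΔ hε hη hw hnarrow hexp
  have hΔ₀ := h.pos
  have hσ₀ : (0 : ℝ) < σ := by positivity
  have hw₀ : 0 < E.weight ψ j₀ := hη.trans_le hw
  have hmass := h.one_eighth_le_gaussianReal_filterInterval hσ (by linarith)
  have hvar := variance_cond_le_of_restrict_eq h.phase_mem_filterInterval
    (h.outcomeLaw_filterInterval_ne_zero hσ hψ hΔ hw₀) (h.gaussianReal_filterInterval_ne_zero hσ)
    (E.targetWeight_ne_zero hσ hw₀) hν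
  rw [show g + Δ / 2 - (g - Δ / 2) = Δ by ring, NNReal.coe_pow] at hvar
  calc _ ≤ (σ : ℝ) ^ 2 / (1 / 8) + Δ ^ 2 * (ε * σ ^ 2 / Δ ^ 3) :=
        hvar.trans (add_le_add (div_le_div_of_nonneg_left (by positivity) (by norm_num) hmass)
          (mul_le_mul_of_nonneg_left hratio (by positivity)))
    _ = 8 * σ ^ 2 + ε / Δ * σ ^ 2 := by field_simp
    _ ≤ 8 * σ ^ 2 + 1 * σ ^ 2 := by
        gcongr
        exact (div_le_one hΔ₀).2 hεΔ
    _ = 9 * σ ^ 2 := by ring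

variable {est : (Fin M → ℝ) → ℝ}

lemma integral_sq_estimate_sub_le_of_narrow (h : E.IsIsolated j₀ g Δ) (hσ : σ ≠ 0)
    (hψ : ‖ψ‖ = 1) (hΔ : Δ ≤ π) (hε : 0 < ε) (hεΔ : ε ≤ Δ) (hη : 0 < η)
    (hw : η ≤ E.weight ψ j₀) (hnarrow : 500 * σ ≤ Δ)
    (hexp : Δ ≤ ε * η * exp ((Δ / (2000 * σ)) ^ 2)) (hM : M ≠ 0)
    (hMσ : 3000000 * σ ^ 2 ≤ M * ε ^ 2)
    (hest : ∀ x : Fin M → ℝ, (∀ i, x i ∈ filterInterval g Δ) →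
      IsFMPE (gaussianKernel σ) (filterInterval g Δ) x (est x)) :
    ∫ x, (est x - E.phase j₀) ^ 2
      ∂Measure.pi (fun _ => (E.outcomeLaw ψ (gaussianKernel σ))[|filterInterval g Δ]) ≤
        ε ^ 2 := by
  have hbias :=
    h.abs_integral_cond_outcomeLaw_sub_truncatedMean_le hσ hψ hΔ hε hη hw hnarrow hexp
  have hvar := h.variance_cond_outcomeLaw_le hσ hψ hΔ hε hεΔ hη hw hnarrow hexp
  have hσ₀ : (0 : ℝ) < σ := by positivity
  have hlen : g + Δ / 2 - (g - Δ / 2) = Δ := by ring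
  have : IsProbabilityMeasure
      ((E.outcomeLaw ψ (gaussianKernel σ))[|Icc (g - Δ / 2) (g + Δ / 2)]) :=
    cond_isProbabilityMeasure (h.outcomeLaw_filterInterval_ne_zero hσ hψ hΔ (hη.trans_le hw))
  have hmse := sq_mul_integral_sq_estimate_sub_le
    (P := (E.outcomeLaw ψ (gaussianKernel σ))[|Icc (g - Δ / 2) (g + Δ / 2)]) hσ
    (by linarith [h.pos]) (hlen.trans_le hΔ) hM
    (ae_cond_mem measurableSet_Icc) hest h.phase_mem_filterInterval (by norm_num)
    fun ξ hξ => one_div_le_variance_cond_gaussianReal_div hσ (by linarith) hξ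
  have hvarM : Var[id; (E.outcomeLaw ψ (gaussianKernel σ))[|filterInterval g Δ]] / M ≤
      3 / 1000000 * ε ^ 2 := by
    rw [div_le_iff₀ (by positivity)]
    linarith
  have hbias' := sq_le_sq' (abs_le.1 hbias).1 (abs_le.1 hbias).2
  have hsum := hmse.trans (add_le_add hvarM hbias')
  refine le_of_mul_le_mul_left (hsum.trans ?_) (by norm_num : (0 : ℝ) < (1 / 384) ^ 2)
  nlinarith [sq_nonneg ε]

lemma integral_sq_estimate_sub_le (h : E.IsIsolated j₀ g Δ) (hσ : σ ≠ 0)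
    (hψ : ‖ψ‖ = 1) (hΔ : Δ ≤ π) (hε : 0 < ε) (hεΔ : ε ≤ Δ) (hη : 0 < η)
    (hw : η ≤ E.weight ψ j₀) (hexp : Δ ≤ ε * η * exp ((Δ / (2000 * σ)) ^ 2)) (hM : M ≠ 0)
    (hMσ : 500 * σ ≤ Δ → 3000000 * σ ^ 2 ≤ M * ε ^ 2)
    (hest : ∀ x : Fin M → ℝ, (∀ i, x i ∈ filterInterval g Δ) →
      IsFMPE (gaussianKernel σ) (filterInterval g Δ) x (est x)) :
    ∫ x, (est x - E.phase j₀) ^ 2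
      ∂Measure.pi (fun _ => (E.outcomeLaw ψ (gaussianKernel σ))[|filterInterval g Δ]) ≤
        ε ^ 2 := by
  rcases le_total (500 * (σ : ℝ)) Δ with hnarrow | hwide
  · exact h.integral_sq_estimate_sub_le_of_narrow hσ hψ hΔ hε hεΔ hη hw hnarrow hexp hM
      (hMσ hnarrow) hest
  · have : IsProbabilityMeasure
        ((E.outcomeLaw ψ (gaussianKernel σ))[|Icc (g - Δ / 2) (g + Δ / 2)]) :=
      cond_isProbabilityMeasure (h.outcomeLaw_filterInterval_ne_zero hσ hψ hΔ (hη.trans_le hw))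
    have hΔε := mul_le_of_le_mul_exp (by positivity) h.pos (hw.trans (E.weight_le_one hψ j₀)) hε
      hwide hexp
    exact integral_sq_estimate_sub_le_of_forall_abs_sub_le hσ (by linarith [h.pos])
      (by linarith) hM (ae_cond_mem measurableSet_Icc) hest
      fun φ hφ => (h.abs_sub_phase_le hφ).trans hΔε

variable {Ω : Type*} [MeasurableSpace Ω] {μ : Measure Ω}
  {X : Fin M → ℕ → Ω → ℝ}

lemma rmse_estimate_filteredSamples_le (h : E.IsIsolated j₀ g Δ) (hσ : σ ≠ 0)
    (hψ : ‖ψ‖ = 1) (hΔ : Δ ≤ π) (hε : 0 < ε) (hεΔ : ε ≤ Δ) (hη : 0 < η)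
    (hw : η ≤ E.weight ψ j₀) (hexp : Δ ≤ ε * η * exp ((Δ / (2000 * σ)) ^ 2)) (hM : M ≠ 0)
    (hMσ : 500 * σ ≤ Δ → 3000000 * σ ^ 2 ≤ M * ε ^ 2)
    (hest : ∀ x : Fin M → ℝ, (∀ i, x i ∈ filterInterval g Δ) →
      IsFMPE (gaussianKernel σ) (filterInterval g Δ) x (est x))
    (hlaw : ∀ i k, HasLaw (X i k) (E.outcomeLaw ψ (gaussianKernel σ)) μ)
    (hind : iIndepFun (fun p : Fin M × ℕ => X p.1 p.2) μ) :
    Integrable (fun ω => (est (filteredSamples (filterInterval g Δ) fun i k => X i k ω) -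
        E.phase j₀) ^ 2) μ ∧
      √(∫ ω, (est (filteredSamples (filterInterval g Δ) fun i k => X i k ω) -
        E.phase j₀) ^ 2 ∂μ) ≤ ε := by
  have hPD := h.outcomeLaw_filterInterval_ne_zero hσ hψ hΔ (hη.trans_le hw)
  have : IsProbabilityMeasure
      ((E.outcomeLaw ψ (gaussianKernel σ))[|Icc (g - Δ / 2) (g + Δ / 2)]) :=
    cond_isProbabilityMeasure hPD
  have hsamples :=
    hasLaw_filteredSamples (D := filterInterval g Δ) measurableSet_Icc hPD hlaw hind
  have hinteg : Integrable (fun x => (est x - E.phase j₀) ^ 2)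
      (Measure.pi fun _ => (E.outcomeLaw ψ (gaussianKernel σ))[|filterInterval g Δ]) :=
    integrable_sq_estimate_sub hσ (by linarith [h.pos]) (by linarith) hM
      (ae_cond_mem measurableSet_Icc) hest (E.phase j₀)
  have hmse := h.integral_sq_estimate_sub_le hσ hψ hΔ hε hεΔ hη hw hexp hM hMσ hest
  rw [← hsamples.map_eq] at hinteg hmse
  rw [integral_map hsamples.aemeasurable hinteg.aestronglyMeasurable] at hmse
  exact ⟨hinteg.comp_aemeasurable hsamples.aemeasurable, sqrt_le_iff.2 ⟨hε.le, hmse⟩⟩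

lemma lintegral_totalRuns_le (h : E.IsIsolated j₀ g Δ) (hσ : σ ≠ 0)
    (hψ : ‖ψ‖ = 1) (hΔ : Δ ≤ π) (hη : 0 < η) (hw : η ≤ E.weight ψ j₀)
    (hlaw : ∀ i k, HasLaw (X i k) (E.outcomeLaw ψ (gaussianKernel σ)) μ)
    (hind : iIndepFun (fun p : Fin M × ℕ => X p.1 p.2) μ) :
    ∫⁻ ω, totalRuns (filterInterval g Δ) (fun i k => X i k ω) ∂μ ≤
      ENNReal.ofReal (8 * η⁻¹ * (M * (σ / min (σ : ℝ) Δ))) := by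
  have hσ₀ : (0 : ℝ) < σ := by positivity
  have hmin : 0 < min (σ : ℝ) Δ := lt_min hσ₀ h.pos
  have hq : 0 < η * (min (σ : ℝ) Δ / (8 * σ)) := by positivity
  have hacc : ENNReal.ofReal (η * (min (σ : ℝ) Δ / (8 * σ))) ≤
      E.outcomeLaw ψ (gaussianKernel σ) (filterInterval g Δ) := by
    refine le_trans ?_ (h.ofReal_weight_mul_le_outcomeLaw hσ hψ hΔ)
    gcongr
  calc ∫⁻ ω, totalRuns (filterInterval g Δ) (fun i k => X i k ω) ∂μ
      = M * (E.outcomeLaw ψ (gaussianKernel σ) (filterInterval g Δ))⁻¹ :=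
        lintegral_totalRuns measurableSet_Icc hlaw hind
    _ ≤ M * (ENNReal.ofReal (η * (min (σ : ℝ) Δ / (8 * σ))))⁻¹ := by gcongr
    _ = ENNReal.ofReal (8 * η⁻¹ * (M * (σ / min (σ : ℝ) Δ))) := by
        rw [← ENNReal.ofReal_inv_of_pos hq, ← ENNReal.ofReal_natCast,
          ← ENNReal.ofReal_mul (by positivity)]
        congr 1
        field_simp

end EigenDecomposition.IsIsolated

lemma lintegral_totalCalls_le {Ω : Type*} [MeasurableSpace Ω] {μ : Measure Ω} {D : Set ℝ}
    {M t : ℕ} {X : Fin M → ℕ → Ω → ℝ} {r : ℝ}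
    (hruns : ∫⁻ ω, totalRuns D (fun i k => X i k ω) ∂μ ≤ ENNReal.ofReal r) :
    ∫⁻ ω, totalCalls t D (fun i k => X i k ω) ∂μ ≤ ENNReal.ofReal (t * r) := by
  simp only [totalCalls]
  rw [lintegral_const_mul' _ _ (ENNReal.natCast_ne_top t), ENNReal.ofReal_mul t.cast_nonneg,
    ENNReal.ofReal_natCast]
  gcongr

end

end PhaseEstimation

open PhaseEstimation

theorem theorem3_general {κ : ℝ} (hκ : 0 < κ) :
    ∃ c₀ : ℝ, 0 < c₀ ∧ ∀ B : ℝ, 0 < B → ∃ C : ℝ, 0 < C ∧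
    ∀ (Δ η ε σ : ℝ) (t : ℕ),
      0 < Δ → Δ ≤ Real.pi → 0 < η → 0 < ε → ε ≤ Δ → 0 < σ → 0 < t → t * σ ≤ κ →
      c₀ * Δ⁻¹ * √(Real.log (Δ * ε⁻¹ * η⁻¹)) ≤ t → t * ε ≤ B →
      ∃ M : ℕ, 1 ≤ M ∧
      ∀ (H : Type*) [NormedAddCommGroup H] [InnerProductSpace ℂ H] (U : H ≃ₗᵢ[ℂ] H)
        (ι : Type*) [Fintype ι] (E : EigenDecomposition U ι) (j₀ : ι) (ψ : H) (g : ℝ),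
        (∀ j, j ≠ j₀ → Δ < |E.phase j - E.phase j₀|) →
        ‖ψ‖ = 1 → η < E.weight ψ j₀ → |E.phase j₀ - g| < Δ / 3 →
        filterInterval g Δ ⊆ Set.Ico (Δ / 6) (2 * Real.pi - Δ / 6) →
        (∀ x : Fin M → ℝ, (∀ i, x i ∈ filterInterval g Δ) →
          ∃! φ : ℝ, IsFMPE (gaussianKernel σ) (filterInterval g Δ) x φ) ∧
        ∀ (est : (Fin M → ℝ) → ℝ),
          (∀ x : Fin M → ℝ, (∀ i, x i ∈ filterInterval g Δ) →
            IsFMPE (gaussianKernel σ) (filterInterval g Δ) x (est x)) →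
        ∀ (Ω : Type*) [MeasurableSpace Ω] (μ : Measure Ω) [IsProbabilityMeasure μ]
          (X : Fin M → ℕ → Ω → ℝ),
          (∀ i k, HasLaw (X i k) (E.outcomeLaw ψ (gaussianKernel σ)) μ) →
          iIndepFun (fun (p : Fin M × ℕ) => X p.1 p.2) μ →
          (Integrable (fun ω => (est (filteredSamples (filterInterval g Δ) fun i k => X i k ω) -
              E.phase j₀) ^ 2) μ ∧
            √(∫ ω, (est (filteredSamples (filterInterval g Δ) fun i k => X i k ω) -
              E.phase j₀) ^ 2 ∂μ) ≤ ε) ∧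
          ∫⁻ ω, totalRuns (filterInterval g Δ) (fun i k => X i k ω) ∂μ
            ≤ ENNReal.ofReal (C * η⁻¹ * ((t : ℝ) ^ 2)⁻¹ * (ε ^ 2)⁻¹) ∧
          ∫⁻ ω, totalCalls t (filterInterval g Δ) (fun i k => X i k ω) ∂μ
            ≤ ENNReal.ofReal (C * η⁻¹ * (t : ℝ)⁻¹ * (ε ^ 2)⁻¹) := by
  refine ⟨2000 * κ, by positivity, fun B hB =>
    ⟨8 * (3000000 * κ ^ 2 + B ^ 2), by positivity, ?_⟩⟩
  intro Δ η ε σ t hΔ₀ hΔ hη hε hεΔ hσ₀ ht₀ htσ ht htε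
  have hexp := le_mul_exp_of_mul_sqrt_log_le hκ (by norm_num) hΔ₀ hη hε hσ₀ htσ ht
  obtain ⟨M, hM, hMσ, hMcost⟩ := exists_sampleSize hσ₀ hε hεΔ
  have hcost := hMcost.trans
    (mul_sq_div_sq_add_one_le (by norm_num) hε hσ₀.le (Nat.cast_pos.2 ht₀) htσ htε)
  lift σ to NNReal using hσ₀.le
  have hσ : σ ≠ 0 := (NNReal.coe_pos.1 hσ₀).ne'
  refine ⟨M, Nat.one_le_iff_ne_zero.2 hM, fun H _ _ U ι _ E j₀ ψ g hgap hψ hw hguess hsub =>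
    ⟨fun x hx => existsUnique_isFMPE hσ (by linarith) (by linarith) hM hx,
      fun est hest Ω _ μ _ X hlaw hind => ?_⟩⟩
  have h : E.IsIsolated j₀ g Δ := ⟨hgap, hguess, hsub⟩
  have : IsProbabilityMeasure (E.outcomeLaw ψ (gaussianKernel σ)) :=
    (hlaw ⟨0, Nat.pos_of_ne_zero hM⟩ 0).isProbabilityMeasure_iff.1 inferInstance
  have hruns : ∫⁻ ω, totalRuns (filterInterval g Δ) (fun i k => X i k ω) ∂μ ≤ ENNReal.ofReal
      (8 * (3000000 * κ ^ 2 + B ^ 2) * η⁻¹ * ((t : ℝ) ^ 2)⁻¹ * (ε ^ 2)⁻¹) :=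
    (h.lintegral_totalRuns_le hσ hψ hΔ hη hw.le hlaw hind).trans <| ENNReal.ofReal_le_ofReal <|
      (mul_le_mul_of_nonneg_left hcost (by positivity)).trans_eq (by ring)
  refine ⟨h.rmse_estimate_filteredSamples_le hσ hψ hΔ hε hεΔ hη hw.le hexp hM hMσ hest hlaw hind,
    hruns, (lintegral_totalCalls_le hruns).trans_eq (congrArg _ ?_)⟩
  field_simp

theorem theorem3 (κ₁ κ₂ : ℝ) (hκ₁ : 0 < κ₁) (hκ₂ : κ₁ ≤ κ₂) :
    -- the constant in the lower bound on `t`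
    ∃ c₀ : ℝ, 0 < c₀ ∧
    -- the constant `C` in the cost bounds may depend on the bound `B` for `t * ε`
    ∀ B : ℝ, 0 < B → ∃ C : ℝ, 0 < C ∧
    ∀ (Δ η ε σ : ℝ) (t : ℕ),
      0 < Δ → Δ ≤ Real.pi → 0 < η → 0 < ε → ε ≤ Δ → 0 < σ →
      -- a circuit with `t` calls to `U` has a kernel of width `σ = Θ(1/t)`
      κ₁ ≤ t * σ → t * σ ≤ κ₂ →
      c₀ * Δ⁻¹ * Real.sqrt (Real.log (Δ * ε⁻¹ * η⁻¹)) ≤ t →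
      t * ε ≤ B →
      -- the number `M` of filtered samples is chosen without knowledge of `U` and `ψ`
      ∃ M : ℕ, 1 ≤ M ∧
      ∀ (H : Type*) [NormedAddCommGroup H] [InnerProductSpace ℂ H] (U : H ≃ₗᵢ[ℂ] H)
        (ι : Type*) [Fintype ι] (E : PhaseEstimation.EigenDecomposition U ι) (j₀ : ι)
        (ψ : H) (g : ℝ),
        (∀ j, j ≠ j₀ → Δ < |E.phase j - E.phase j₀|) →
        ‖ψ‖ = 1 → η < E.weight ψ j₀ →
        |E.phase j₀ - g| < Δ / 3 →
        PhaseEstimation.filterInterval g Δ ⊆ Set.Ico (Δ / 6) (2 * Real.pi - Δ / 6) →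
        -- the estimate is well defined
        (∀ x : Fin M → ℝ, (∀ i, x i ∈ PhaseEstimation.filterInterval g Δ) →
          ∃! φ : ℝ, PhaseEstimation.IsFMPE (PhaseEstimation.gaussianKernel σ)
            (PhaseEstimation.filterInterval g Δ) x φ) ∧
        ∀ (est : (Fin M → ℝ) → ℝ),
          (∀ x : Fin M → ℝ, (∀ i, x i ∈ PhaseEstimation.filterInterval g Δ) →
            PhaseEstimation.IsFMPE (PhaseEstimation.gaussianKernel σ)
              (PhaseEstimation.filterInterval g Δ) x (est x)) →
        -- independent circuit runs
        ∀ (Ω : Type*) [MeasurableSpace Ω] (μ : Measure Ω) [IsProbabilityMeasure μ]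
          (X : Fin M → ℕ → Ω → ℝ),
          (∀ i k, HasLaw (X i k) (E.outcomeLaw ψ (PhaseEstimation.gaussianKernel σ)) μ) →
          iIndepFun (fun (p : Fin M × ℕ) => X p.1 p.2) μ →
          -- root-mean-square error
          (Integrable (fun ω => (est (PhaseEstimation.filteredSamples
              (PhaseEstimation.filterInterval g Δ) fun i k => X i k ω) - E.phase j₀) ^ 2) μ ∧
            Real.sqrt (∫ ω, (est (PhaseEstimation.filteredSamples
              (PhaseEstimation.filterInterval g Δ) fun i k => X i k ω) - E.phase j₀) ^ 2 ∂μ)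
                ≤ ε) ∧
          -- expected number of circuit samples
          ∫⁻ ω, PhaseEstimation.totalRuns (PhaseEstimation.filterInterval g Δ)
              (fun i k => X i k ω) ∂μ
            ≤ ENNReal.ofReal (C * η⁻¹ * ((t : ℝ) ^ 2)⁻¹ * (ε ^ 2)⁻¹) ∧
          -- expected total number of calls to `U`
          ∫⁻ ω, PhaseEstimation.totalCalls t (PhaseEstimation.filterInterval g Δ)
              (fun i k => X i k ω) ∂μ
            ≤ ENNReal.ofReal (C * η⁻¹ * (t : ℝ)⁻¹ * (ε ^ 2)⁻¹) := by
  obtain ⟨c₀, hc₀, hB⟩ := theorem3_general (hκ₁.trans_le hκ₂)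
  refine ⟨c₀, hc₀, fun B hBpos => ?_⟩
  obtain ⟨C, hC, hcost⟩ := hB B hBpos
  refine ⟨C, hC, fun Δ η ε σ t hΔ₀ hΔ hη hε hεΔ hσ hκt => ?_⟩
  exact hcost Δ η ε σ t hΔ₀ hΔ hη hε hεΔ hσ
    (Nat.cast_pos.1 (pos_of_mul_pos_left (hκ₁.trans_le hκt) hσ.le))
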